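/- **Setting.** Let $d\ge 0$ and let $(X,Y)$ be a random vector with values in $\mathbb R^d\times\mathbb R$, and let $\mathcal X\subseteq\mathbb R^d$ be a set with $X\in\mathcal X$ almost surely (the value space of $X$). Fix a regular conditional distribution of $Y$ given $X$. Suppose that for each $x\in\mathcal X$ the cdf $F_x$ of $Y\mid X=x$ is continuous and strictly increasing on $(0,\infty)$, that $F_x(y)=0$ for $y\le 0$, and that the quantile function of $Z\mid X=x$, where $Z=\log Y$, is $$\beta_0(p)+\beta_1(p)x_1+\cdots+\beta_d(p)x_d,\qquad p\in(0,1),$$ where $\beta_0,\dots,\beta_d$ are nondecreasing and continuous on $[\eta,1-\eta]$ for each $\eta\in(0,\tfrac12)$. Let $Q_x(p)=\inf\{t:F_x(t)\ge p\}$ be the quantile function of $Y\mid X=x$. For $Q:(0,1)\to(0,\infty)$ put $qZ(p;Q)=1-Q(p/2)/Q(1/2+p/2)$ for $p\in(0,1)$, and $qZ(0;Q)=qZ(1;Q)=1$. Let $(X_1,Y_1),(X_2,Y_2),\dots$ be independent copies of $(X,Y)$ and $Z_i=\log Y_i$. Assume: * (A1) $X$ has a Lebesgue density that is positive on a set $V$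 with $P(X\in V)=1$ and continuous at $\mathbf 0\in\mathbb R^d$; * (A2) for each $x\in\mathcal X$ the conditional distribution of $Z\mid X=x$ has a density that is Hölder continuous in an open neighbourhood of $0$; * (A3) $\frac1n \mathbf X^{*T}\mathbf X^{*}\to A$ in probability as $n\to\infty$ for a positive definite matrix $A$, where $\mathbf X^*$ is the $n\times(d+1)$ matrix whose $i$-th row is $(1,X_i^T)$. **Estimators.** For $\tau>0$ let $$g_\tau(u)=\tau\left[\log(e^{-u/\tau}+1)+\log(e^{u/\tau}+1)\right],\quad h_\tau(u)=u\tanh(u/\tau),\quad f_\tau=\tfrac12(g_\tau+h_\tau).$$ Let $\tau_n>0$ with $\tau_n\to0$. For $m,n\in\mathbb N$ and $p_j=j/m$, $1\le j\le m-1$, let $\hat\beta^{(m,n)}_{\tau_n}(p_j)\in\mathbb R^{d+1}$ be any minimiser over $b\in\mathbb R^{d+1}$ of $$\sum_{i=1}^n\left[f_{\tau_n}\bigl(Z_i-b^T(1,X_i)\bigr)+(2p_j-1)\bigl(Z_i-b^T(1,X_i)\bigr)\right]$$ (AQR). For each coordinate $i\in\{0,\dots,d\}$ let $\tilde\beta^{(m,n)}_{\tau_n,i}(p_1)\le\dots\le\tilde\beta^{(m,n)}_{\tau_n,i}(p_{m-1})$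 be the isotonic regression of $\hat\beta^{(m,n)}_{\tau_n,i}(p_1),\dots,\hat\beta^{(m,n)}_{\tau_n,i}(p_{m-1})$, that is, the nondecreasing sequence minimising $\sum_{j=1}^{m-1}[\tilde\beta_i(p_j)-\hat\beta_i(p_j)]^2$ (IAQR). Both are extended to $[p_1,p_{m-1}]$ by linear interpolation. Let $\hat Q^{(m,n)}_{\tau_n,x}(p)=\exp\bigl(\hat\beta^{(m,n)}_{\tau_n}(p)^T(1,x)\bigr)$, and define $\tilde Q^{(m,n)}_{\tau_n,x}$ in the same way from $\tilde\beta^{(m,n)}_{\tau_n}$. **Theorem.** For random functions, "$\xi^{(m,n)}\xrightarrow{P}\xi$ on $[\eta,1-\eta]$" means $P\bigl(\sup_{p\in[\eta,1-\eta]}|\xi^{(m,n)}(p)-\xi(p)|>\varepsilon\bigr)\to0$ for every $\varepsilon>0$ as $m,n\to\infty$ jointly (for every $\delta>0$ there are $m_0,n_0$ such that the probability is at most $\delta$ for all $m\geq m_0$, $n\geq n_0$; outer probability if the event is not measurable). For each $\eta\in(0,\frac12)$ and each $x\in\mathcal X$, as $m,n\to\infty$: 1. $\hat\beta^{(m,n)}_{\tau_n,i}\xrightarrow{P}\beta_i$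 on $[\eta,1-\eta]$ for $i=0,\dots,d$; 2. $\tilde\beta^{(m,n)}_{\tau_n,i}\xrightarrow{P}\beta_i$ on $[\eta,1-\eta]$ for $i=0,\dots,d$; 3. $\hat Q^{(m,n)}_{\tau_n,x}\xrightarrow{P}Q_x$ and $\tilde Q^{(m,n)}_{\tau_n,x}\xrightarrow{P}Q_x$ on $[\eta,1-\eta]$; 4. $qZ(\cdot\,;\hat Q^{(m,n)}_{\tau_n,x})\xrightarrow{P}qZ(\cdot\,;Q_x)$ and $qZ(\cdot\,;\tilde Q^{(m,n)}_{\tau_n,x})\xrightarrow{P}qZ(\cdot\,;Q_x)$ on $[\eta,1-\eta]$; 5. $\int_\eta^{1-\eta}qZ(p;\hat Q^{(m,n)}_{\tau_n,x})\,dp\xrightarrow{P}\int_\eta^{1-\eta}qZ(p;Q_x)\,dp$ and $\int_\eta^{1-\eta}qZ(p;\tilde Q^{(m,n)}_{\tau_n,x})\,dp\xrightarrow{P}\int_\eta^{1-\eta}qZ(p;Q_x)\,dp$; where the assertions about the isotonic estimators ($\tilde\beta$, $\tilde Q$) are made under the additional integrability condition $E|\log Y|<\infty$; the assertions about $\hat\beta$,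 $\hat Q$ do not need it. -/

import Mathlib

open Filter Topology MeasureTheory ProbabilityTheory Set

noncomputable section

/-! ### Quantile functions and the inequality curve `qZ` -/

/-- The quantile function `Q(p) = inf {t : F(t) ≥ p}` of a probability measure `ν` on `ℝ`
with cdf `F` (used for `p ∈ (0,1)`). -/
def quantile (ν : Measure ℝ) (p : ℝ) : ℝ := sInf {t : ℝ | p ≤ cdf ν t}

/-- `qZ(p;Q) = 1 - Q(p/2) / Q(1/2+p/2)` for `p ∈ (0,1)`, and `qZ(0;Q) = qZ(1;Q) = 1`. -/
def qZ (Q : ℝ → ℝ) (p : ℝ) : ℝ :=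
  if p = 0 ∨ p = 1 then 1 else 1 - Q (p / 2) / Q (1 / 2 + p / 2)

/-! ### The linear quantile regression model -/

/-- `b₀ + b₁ x₁ + ⋯ + b_d x_d`. -/
def linPred {d : ℕ} (b : Fin (d + 1) → ℝ) (x : Fin d → ℝ) : ℝ :=
  b 0 + ∑ k : Fin d, b k.succ * x k

/-- `κ` is a (regular) conditional distribution of `Y` given `X`, `S` is a value space of `X`,
for every `x ∈ S` the cdf of `Y | X = x` is continuous and increasing on `(0,∞)` and vanishes on
`(-∞,0]`, and the quantile function of `log Y | X = x` is `β₀(p) + β₁(p) x₁ + ⋯ + β_d(p) x_d`, with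
coefficient functions that are nondecreasing and continuous on each `[η, 1-η]`. -/
structure QRModel {Ω : Type*} [MeasurableSpace Ω] (μ : Measure Ω) {d : ℕ}
    (X : Ω → Fin d → ℝ) (Y : Ω → ℝ) (S : Set (Fin d → ℝ)) (κ : Kernel (Fin d → ℝ) ℝ)
    (β : Fin (d + 1) → ℝ → ℝ) : Prop where
  measurable_X : Measurable X
  measurable_Y : Measurable Y
  mem_values : ∀ᵐ ω ∂μ, X ω ∈ S
  condLaw : μ.map (fun ω => (X ω, Y ω)) = (μ.map X) ⊗ₘ κ
  cdf_continuousOn : ∀ x ∈ S, ContinuousOn (fun y => cdf (κ x) y) (Ioi 0)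
  cdf_strictMonoOn : ∀ x ∈ S, StrictMonoOn (fun y => cdf (κ x) y) (Ioi 0)
  cdf_eq_zero : ∀ x ∈ S, ∀ y ≤ (0 : ℝ), cdf (κ x) y = 0
  beta_monotoneOn : ∀ i, ∀ η ∈ Ioo (0 : ℝ) (1 / 2), MonotoneOn (β i) (Icc η (1 - η))
  beta_continuousOn : ∀ i, ∀ η ∈ Ioo (0 : ℝ) (1 / 2), ContinuousOn (β i) (Icc η (1 - η))
  quantile_log : ∀ x ∈ S, ∀ p ∈ Ioo (0 : ℝ) 1,
    quantile ((κ x).map Real.log) p = linPred (fun i => β i p) x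

/-- `X` has a density with respect to Lebesgue measure that is positive on a set `V` carrying the
distribution of `X`, and continuous at the zero vector. -/
def CovariateDensity {Ω : Type*} [MeasurableSpace Ω] (μ : Measure Ω) {d : ℕ}
    (X : Ω → Fin d → ℝ) : Prop :=
  ∃ (V : Set (Fin d → ℝ)) (f : (Fin d → ℝ) → ℝ),
    Measurable f ∧ (∀ x, 0 ≤ f x) ∧
    μ.map X = volume.withDensity (fun x => ENNReal.ofReal (f x)) ∧
    (∀ᵐ ω ∂μ, X ω ∈ V) ∧ (∀ x ∈ V, 0 < f x) ∧ ContinuousAt f 0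

/-- For each `x ∈ S`, the conditional distribution of `log Y` given `X = x` has a density that is
Hölder continuous on an open neighbourhood of `0`. -/
def HolderCondDensity {d : ℕ} (S : Set (Fin d → ℝ)) (κ : Kernel (Fin d → ℝ) ℝ) : Prop :=
  ∀ x ∈ S, ∃ h : ℝ → ℝ, Measurable h ∧ (∀ z, 0 ≤ h z) ∧
    (κ x).map Real.log = volume.withDensity (fun z => ENNReal.ofReal (h z)) ∧
    ∃ (U : Set ℝ) (C r : NNReal), IsOpen U ∧ (0 : ℝ) ∈ U ∧ 0 < r ∧ HolderOnWith C r h U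

/-- The `n × (d+1)` design matrix: a column of ones followed by the covariate columns. -/
def designMatrix {d : ℕ} (n : ℕ) (x : ℕ → Fin d → ℝ) : Matrix (Fin n) (Fin (d + 1)) ℝ :=
  Matrix.of fun i k => (Fin.cons 1 (x i) : Fin (d + 1) → ℝ) k

/-- `n⁻¹ X*ᵀ X*` converges in probability (entrywise) to a positive definite matrix. -/
def DesignConvergence {Ω : Type*} [MeasurableSpace Ω] (μ : Measure Ω) {d : ℕ}
    (Xs : ℕ → Ω → Fin d → ℝ) : Prop :=
  ∃ A : Matrix (Fin (d + 1)) (Fin (d + 1)) ℝ, A.PosDef ∧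
    ∀ k l, TendstoInMeasure μ
      (fun (n : ℕ) ω => ((1 / (n : ℝ)) •
        ((designMatrix n (fun i => Xs i ω)).transpose * designMatrix n (fun i => Xs i ω))) k l)
      atTop (fun _ => A k l)

/-! ### The smoothed loss and the estimators -/

/-- `g_τ(u) = τ [log(e^{-u/τ} + 1) + log(e^{u/τ} + 1)]`. -/
def gSmooth (τ u : ℝ) : ℝ :=
  τ * (Real.log (Real.exp (-u / τ) + 1) + Real.log (Real.exp (u / τ) + 1))

/-- `h_τ(u) = u tanh(u/τ)`. -/
def hSmooth (τ u : ℝ) : ℝ := u * Real.tanh (u / τ)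

/-- `f_τ = (g_τ + h_τ) / 2`. -/
def fSmooth (τ u : ℝ) : ℝ := (gSmooth τ u + hSmooth τ u) / 2

/-- The criterion `∑ᵢ [f_τ(zᵢ - bᵀxᵢ) + (2p-1)(zᵢ - bᵀxᵢ)]` over the first `n` observations. -/
def aqrObjective {d : ℕ} (τ p : ℝ) (n : ℕ) (x : ℕ → Fin d → ℝ) (z : ℕ → ℝ)
    (b : Fin (d + 1) → ℝ) : ℝ :=
  ∑ i ∈ Finset.range n,
    (fSmooth τ (z i - linPred b (x i)) + (2 * p - 1) * (z i - linPred b (x i)))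

/-- `b` is a value of the AQR estimator of `β(p)`: a global minimiser of the criterion. -/
def IsAQR {d : ℕ} (τ p : ℝ) (n : ℕ) (x : ℕ → Fin d → ℝ) (z : ℕ → ℝ)
    (b : Fin (d + 1) → ℝ) : Prop :=
  ∀ c : Fin (d + 1) → ℝ, aqrObjective τ p n x z b ≤ aqrObjective τ p n x z c

/-- `t₁ ≤ ⋯ ≤ t_{m-1}` is the (unweighted) isotonic regression of `a₁, …, a_{m-1}`. -/
def IsIsotonicRegression (m : ℕ) (a t : ℕ → ℝ) : Prop :=
  MonotoneOn t (Ico 1 m) ∧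
    ∀ s : ℕ → ℝ, MonotoneOn s (Ico 1 m) →
      ∑ j ∈ Finset.Ico 1 m, (t j - a j) ^ 2 ≤ ∑ j ∈ Finset.Ico 1 m, (s j - a j) ^ 2

/-- Linear interpolation between the points `(j/m, v j)`, `j = 1, …, m-1`; it is meant for
`p ∈ [1/m, (m-1)/m]`. -/
def linInterp (m : ℕ) (v : ℕ → ℝ) (p : ℝ) : ℝ :=
  let j : ℕ := ⌊p * m⌋₊
  v j + (p - (j : ℝ) / m) * ((v (j + 1) - v j) / (((j : ℝ) + 1) / m - (j : ℝ) / m))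

/-- The coefficient functions obtained from the vectors `c j` at the orders `j/m`. -/
def coefCurve {d : ℕ} (m : ℕ) (c : ℕ → Fin (d + 1) → ℝ) (i : Fin (d + 1)) (p : ℝ) : ℝ :=
  linInterp m (fun j => c j i) p

/-- The plug-in estimator of `Q_x` based on the coefficient functions `B`. -/
def plugInQ {d : ℕ} (B : Fin (d + 1) → ℝ → ℝ) (x : Fin d → ℝ) (p : ℝ) : ℝ :=
  Real.exp (linPred (fun i => B i p) x)

/-- Convergence in probability, uniformly on `s`, of random functions `F a` to `G` along `l`:
`P(sup_{p ∈ s} |F a p - G p| > ε) → 0` for every `ε > 0`. -/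
def TendstoInProbUniformlyOn {Ω ι : Type*} [MeasurableSpace Ω] (μ : Measure Ω)
    (F : ι → Ω → ℝ → ℝ) (G : ℝ → ℝ) (l : Filter ι) (s : Set ℝ) : Prop :=
  ∀ ε : ℝ, 0 < ε → Tendsto (fun a => μ {ω | ∃ p ∈ s, ε < |F a ω p - G p|}) l (𝓝 0)

end

/-!
# Consistency of smoothed quantile regression and of its isotonic version

The smoothed loss `f_τ` differs from `|·|` by at most `τ` (`abs_fSmooth_sub_abs_le`), so an estimate
of order `p` is a `2 τ_n`-approximate minimiser of the convex function `excessLoss n x z p`, which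
is affine in `p` and involves the responses through `|z - bᵀx| - |z|` only. A uniform law of large
numbers on balls (`IsIIDCopies.highProb_mean_uniform`) shows that it is close to `populationLoss`,
whose unique minimiser is `β(p)` (`QRModel.integral_checkLoss_sub_pos`). Convexity and compactness
of `[η, 1 - η]` give closeness of all approximate minimisers to `β(p)`, simultaneously in `p`
(`exists_approx_argmin_close`, `highProb_aqr_close`). The covariates are integrable because
averages of their squares converge in probability (`IsIIDCopies.integrable_of_highProb`). Since
the event obtained does not depend on the grid size `m`, the joint limit in `m` and `n` causes no
difficulty. The responses need not be integrable up to this point.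

An isotonic regression at an inner order may average over values of extreme order, where the
estimates are not consistent. What is needed is that the fits of orders `j / m ≤ η'` have a small
accumulated norm `m⁻¹ ∑ ‖b(j/m)‖`. The individual bound `‖b(p)‖ ≤ C / p` is not enough; instead
one uses that the minimal value `V(p)` of the criterion is concave in `p`, with slope twice the mean
residual, so that the mean residuals of the lowest orders sum up to at most `m (V(η') + τ) / 2`
(`sum_mean_residual_le`). The mean residual controls the mean absolute residual and hence, by
nondegeneracy of the covariates, the norm of the fit (`sum_norm_le_of_isAQR`). If `log Y` is
integrable, `V(η')` is small for small `η'`, as comparison with a constant predictor shows. The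
highest orders follow by reflecting the responses. Together with one half of the min-max formula
(`IsIsotonicRegression.exists_forall_mul_le`) and its reflection this proves that the isotonic
regressions are close to `β` on inner grid points (`exists_isotonic_close`).

Interpolation, `exp`, the ratio in `qZ` and the integral preserve uniform closeness
(`exists_linInterp_close`, `QRModel.tendsto_of_coef`).
-/

noncomputable section

/-! ### The smoothed absolute value -/

lemma gSmooth_bounds {τ : ℝ} (hτ : 0 < τ) (u : ℝ) :
    |u| ≤ gSmooth τ u ∧ gSmooth τ u ≤ |u| + 2 * τ := by
  have key : ∀ v : ℝ, |v| ≤ Real.log (Real.exp (-v) + 1) + Real.log (Real.exp v + 1) ∧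
      Real.log (Real.exp (-v) + 1) + Real.log (Real.exp v + 1) ≤ |v| + 2 := by
    intro v
    have h1 : (0 : ℝ) < Real.exp (-v) + 1 := by positivity
    have h2 : (0 : ℝ) < Real.exp v + 1 := by positivity
    have hprod : (Real.exp (-v) + 1) * (Real.exp v + 1) = 2 + Real.exp v + Real.exp (-v) := by
      have : Real.exp (-v) * Real.exp v = 1 := by rw [← Real.exp_add]; simp
      linarith
    rw [← Real.log_mul h1.ne' h2.ne', hprod]
    have e1 : Real.exp v ≤ Real.exp |v| := Real.exp_le_exp.2 (le_abs_self v)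
    have e2 : Real.exp (-v) ≤ Real.exp |v| := Real.exp_le_exp.2 (neg_le_abs v)
    have e3 : (1 : ℝ) ≤ Real.exp |v| := Real.one_le_exp (abs_nonneg v)
    constructor
    · rw [Real.le_log_iff_exp_le (by positivity)]
      rcases abs_cases v with ⟨h, _⟩ | ⟨h, _⟩ <;> rw [h] <;>
        linarith [Real.exp_pos v, Real.exp_pos (-v)]
    · rw [Real.log_le_iff_le_exp (by positivity), Real.exp_add]
      have h4 : (4 : ℝ) ≤ Real.exp 2 := by
        have := Real.add_one_le_exp (1 : ℝ)
        have h : Real.exp 2 = Real.exp 1 * Real.exp 1 := by rw [← Real.exp_add]; norm_num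
        rw [h]; nlinarith
      nlinarith
  obtain ⟨k1, k2⟩ := key (u / τ)
  have hu : |u / τ| * τ = |u| := by
    rw [abs_div, abs_of_pos hτ]; field_simp
  unfold gSmooth
  rw [neg_div]
  constructor
  · nlinarith
  · nlinarith

lemma hSmooth_bounds {τ : ℝ} (hτ : 0 < τ) (u : ℝ) :
    |u| - τ ≤ hSmooth τ u ∧ hSmooth τ u ≤ |u| := by
  have key : ∀ v : ℝ, 0 ≤ v → v - 1 ≤ v * Real.tanh v ∧ v * Real.tanh v ≤ v := by
    intro v hv
    have hp : 0 < Real.exp v + Real.exp (-v) := by positivity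
    have hT : (1 - Real.tanh v) * (Real.exp v + Real.exp (-v)) = 2 * Real.exp (-v) := by
      rw [Real.tanh_eq]; field_simp; ring
    have h0 : 0 ≤ 1 - Real.tanh v := by
      by_contra h
      push Not at h
      nlinarith [Real.exp_pos (-v)]
    refine ⟨?_, by nlinarith⟩
    have h1 : Real.exp v = Real.exp (2 * v) * Real.exp (-v) := by
      rw [← Real.exp_add]; congr 1; ring
    have h2 := Real.add_one_le_exp (2 * v)
    -- `v (1 - tanh v) = 2 v / (e^{2v} + 1) ≤ 1`
    have h3 : v * (1 - Real.tanh v) * (Real.exp v + Real.exp (-v)) ≤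
        1 * (Real.exp v + Real.exp (-v)) := by
      rw [mul_assoc, hT, h1]
      nlinarith [Real.exp_pos (-v)]
    have := le_of_mul_le_mul_right h3 hp
    linarith
  have heq : hSmooth τ u = τ * (|u / τ| * Real.tanh |u / τ|) := by
    unfold hSmooth
    rcases abs_cases (u / τ) with ⟨h, _⟩ | ⟨h, _⟩ <;> rw [h]
    · field_simp
    · rw [Real.tanh_neg]; field_simp
  obtain ⟨k1, k2⟩ := key _ (abs_nonneg (u / τ))
  have hu : τ * |u / τ| = |u| := by
    rw [abs_div, abs_of_pos hτ]; field_simp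
  rw [heq]
  constructor <;> nlinarith

lemma abs_fSmooth_sub_abs_le {τ : ℝ} (hτ : 0 < τ) (u : ℝ) : |fSmooth τ u - (|u|)| ≤ τ := by
  obtain ⟨h1, h2⟩ := gSmooth_bounds hτ u
  obtain ⟨h3, h4⟩ := hSmooth_bounds hτ u
  unfold fSmooth
  rw [abs_le]
  constructor <;> linarith

lemma fSmooth_neg (τ u : ℝ) : fSmooth τ (-u) = fSmooth τ u := by
  simp only [fSmooth, gSmooth, hSmooth, neg_div, neg_neg, Real.tanh_neg]
  ring

/-! ### Linear predictors and averages -/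

lemma linPred_add {d : ℕ} (b c : Fin (d + 1) → ℝ) (x : Fin d → ℝ) :
    linPred (b + c) x = linPred b x + linPred c x := by
  simp only [linPred, Pi.add_apply, add_mul, Finset.sum_add_distrib]; ring

lemma linPred_smul {d : ℕ} (a : ℝ) (b : Fin (d + 1) → ℝ) (x : Fin d → ℝ) :
    linPred (a • b) x = a * linPred b x := by
  simp only [linPred, Pi.smul_apply, smul_eq_mul, mul_add, Finset.mul_sum, mul_assoc]

lemma linPred_neg {d : ℕ} (b : Fin (d + 1) → ℝ) (x : Fin d → ℝ) :
    linPred (-b) x = -linPred b x := by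
  have := linPred_smul (-1) b x
  simpa using this

lemma linPred_sub {d : ℕ} (b c : Fin (d + 1) → ℝ) (x : Fin d → ℝ) :
    linPred (b - c) x = linPred b x - linPred c x := by
  rw [sub_eq_add_neg, linPred_add, linPred_neg, sub_eq_add_neg]

/-- The `ℓ¹` norm of the design vector `(1, x)`. -/
def designNorm {d : ℕ} (x : Fin d → ℝ) : ℝ := 1 + ∑ k, |x k|

lemma designNorm_nonneg {d : ℕ} (x : Fin d → ℝ) : 0 ≤ designNorm x := by
  unfold designNorm; positivity

lemma abs_linPred_le {d : ℕ} (b : Fin (d + 1) → ℝ) (x : Fin d → ℝ) :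
    |linPred b x| ≤ ‖b‖ * designNorm x := by
  have hb : ∀ i, |b i| ≤ ‖b‖ := fun i => norm_le_pi_norm b i
  unfold linPred designNorm
  calc |b 0 + ∑ k : Fin d, b k.succ * x k|
      ≤ |b 0| + |∑ k : Fin d, b k.succ * x k| := abs_add_le _ _
    _ ≤ ‖b‖ + ∑ k : Fin d, ‖b‖ * |x k| := by
        gcongr
        · exact hb 0
        · refine (Finset.abs_sum_le_sum_abs _ _).trans (Finset.sum_le_sum fun k _ => ?_)
          rw [abs_mul]
          gcongr
          exact hb _
    _ = _ := by rw [← Finset.mul_sum]; ring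

/-- The average of the first `n` terms of a sequence. -/
def sampleMean (n : ℕ) (f : ℕ → ℝ) : ℝ := (∑ i ∈ Finset.range n, f i) / n

lemma sampleMean_add (n : ℕ) (f g : ℕ → ℝ) :
    sampleMean n (fun i => f i + g i) = sampleMean n f + sampleMean n g := by
  simp [sampleMean, Finset.sum_add_distrib, add_div]

lemma sampleMean_sub (n : ℕ) (f g : ℕ → ℝ) :
    sampleMean n (fun i => f i - g i) = sampleMean n f - sampleMean n g := by
  simp [sampleMean, sub_div]

lemma sampleMean_const_mul (n : ℕ) (a : ℝ) (f : ℕ → ℝ) :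
    sampleMean n (fun i => a * f i) = a * sampleMean n f := by
  simp [sampleMean, ← Finset.mul_sum, mul_div_assoc]

lemma sampleMean_const {n : ℕ} (hn : 0 < n) (a : ℝ) : sampleMean n (fun _ => a) = a := by
  have : (n : ℝ) ≠ 0 := by positivity
  simp [sampleMean]; field_simp

lemma sampleMean_mono (n : ℕ) {f g : ℕ → ℝ} (h : ∀ i, f i ≤ g i) :
    sampleMean n f ≤ sampleMean n g := by
  unfold sampleMean
  gcongr with i _
  exact h i

lemma abs_sampleMean_le (n : ℕ) (f : ℕ → ℝ) :
    |sampleMean n f| ≤ sampleMean n (fun i => |f i|) := by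
  unfold sampleMean
  rw [abs_div, Nat.abs_cast]
  gcongr
  exact Finset.abs_sum_le_sum_abs _ _

/-! ### Approximate minimisers of convex functions -/

/-- If `M p` has the unique minimiser `β p`, continuously in `p ∈ K`, then approximate minimisers
of convex functions `N p` that are close to `M p` on a large ball are close to `β p`, uniformly in
`p ∈ K`. Convexity turns the gap of `M p` between `β p` and the sphere of radius `δ` around it into
the same gap outside that sphere. -/
lemma exists_approx_argmin_close {E : Type*} [NormedAddCommGroup E] [NormedSpace ℝ E]
    [ProperSpace E] {K : Set ℝ} (hK : IsCompact K) {β : ℝ → E} (hβ : ContinuousOn β K)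
    {M : ℝ → E → ℝ} (hM : Continuous (Function.uncurry M))
    (hmin : ∀ p ∈ K, ∀ b, b ≠ β p → M p (β p) < M p b) {δ : ℝ} (hδ : 0 < δ) :
    ∃ ε > 0, ∃ R, ∀ N : ℝ → E → ℝ, (∀ p ∈ K, ConvexOn ℝ univ (N p)) →
      (∀ p ∈ K, ∀ b, ‖b‖ ≤ R → |N p b - M p b| ≤ ε) →
      ∀ p ∈ K, ∀ c, (∀ b, N p c ≤ N p b + ε) → ‖c - β p‖ < δ := by
  obtain ⟨C, hC⟩ := (hK.image_of_continuousOn hβ).isBounded.exists_norm_le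
  have hcomp : IsCompact (K ×ˢ Metric.sphere (0 : E) δ) := hK.prod (isCompact_sphere 0 δ)
  have hβ' : ContinuousOn (fun q : ℝ × E => β q.1) (K ×ˢ Metric.sphere (0 : E) δ) :=
    hβ.comp continuousOn_fst fun q hq => hq.1
  have hcont : ContinuousOn (fun q : ℝ × E => M q.1 (β q.1 + q.2) - M q.1 (β q.1))
      (K ×ˢ Metric.sphere (0 : E) δ) := by
    refine ContinuousOn.sub ?_ ?_
    · exact hM.comp_continuousOn (continuousOn_fst.prodMk (hβ'.add continuousOn_snd))
    · exact hM.comp_continuousOn (continuousOn_fst.prodMk hβ')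
  obtain ⟨κ, hκ, hκle⟩ := hcomp.exists_forall_le' hcont (a := 0) (by
    rintro ⟨p, u⟩ ⟨hp, hu⟩
    have hu' : u ≠ 0 := by
      rintro rfl
      simp at hu
      exact hδ.ne hu
    have := hmin p hp (β p + u) (by simpa using hu')
    simpa using this)
  refine ⟨κ / 4, by positivity, C + δ, fun N hN hNM p hp c hc => ?_⟩
  by_contra hcon
  push Not at hcon
  have hpos : 0 < ‖c - β p‖ := hδ.trans_le hcon
  have hβC : ‖β p‖ ≤ C := hC _ ⟨p, hp, rfl⟩
  set l : ℝ := δ / ‖c - β p‖ with hl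
  have hl0 : 0 < l := by positivity
  have hl1 : l ≤ 1 := by rw [hl, div_le_one hpos]; exact hcon
  set u : E := l • (c - β p) with hu
  have hun : ‖u‖ = δ := by
    rw [hu, norm_smul, Real.norm_of_nonneg hl0.le, hl]; field_simp
  have h1 : N p (β p + u) ≤ (1 - l) * N p (β p) + l * N p c := by
    have := (hN p hp).2 (mem_univ (β p)) (mem_univ c) (sub_nonneg.2 hl1) hl0.le (by ring)
    have e : (1 - l) • β p + l • c = β p + u := by rw [hu]; module
    rw [e] at this
    simpa using this
  have h2 := hκle (p, u) ⟨hp, by simp [hun]⟩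
  simp only at h2
  have h3 := abs_le.1 (hNM p hp (β p + u) ((norm_add_le _ _).trans (by rw [hun]; gcongr)))
  have h4 := abs_le.1 (hNM p hp (β p) (by linarith))
  have h5 := hc (β p)
  nlinarith

/-! ### The criterion of asymmetric quantile regression -/

lemma abs_aqrObjective_sub_le {d : ℕ} {τ : ℝ} (hτ : 0 < τ) (p : ℝ) {n : ℕ} (hn : 0 < n)
    (x : ℕ → Fin d → ℝ) (z : ℕ → ℝ) (b : Fin (d + 1) → ℝ) :
    |aqrObjective τ p n x z b / n -
      sampleMean n (fun i => |z i - linPred b (x i)| + (2 * p - 1) * (z i - linPred b (x i)))|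
      ≤ τ := by
  have h : aqrObjective τ p n x z b / n = sampleMean n
      (fun i => fSmooth τ (z i - linPred b (x i)) + (2 * p - 1) * (z i - linPred b (x i))) := rfl
  rw [h, ← sampleMean_sub]
  refine (abs_sampleMean_le _ _).trans ((sampleMean_mono n fun i => ?_).trans
    (sampleMean_const hn τ).le)
  have := abs_fSmooth_sub_abs_le hτ (z i - linPred b (x i))
  simpa using this

/-- The excess `n⁻¹ ∑ᵢ (|zᵢ - bᵀxᵢ| - |zᵢ|) - (2p-1) n⁻¹ ∑ᵢ bᵀxᵢ` of the unsmoothed criterion at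
`b` over its value at `0`. Subtracting `|zᵢ|` makes integrability of the responses unnecessary. -/
def excessLoss {d : ℕ} (n : ℕ) (x : ℕ → Fin d → ℝ) (z : ℕ → ℝ) (p : ℝ)
    (b : Fin (d + 1) → ℝ) : ℝ :=
  sampleMean n (fun i => |z i - linPred b (x i)| - |z i|) -
    (2 * p - 1) * sampleMean n (fun i => linPred b (x i))

lemma excessLoss_eq {d : ℕ} (n : ℕ) (x : ℕ → Fin d → ℝ) (z : ℕ → ℝ) (p : ℝ)
    (b : Fin (d + 1) → ℝ) :
    excessLoss n x z p b =
      sampleMean n (fun i => |z i - linPred b (x i)| + (2 * p - 1) * (z i - linPred b (x i))) -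
        sampleMean n (fun i => |z i| + (2 * p - 1) * z i) := by
  unfold excessLoss
  rw [← sampleMean_const_mul, ← sampleMean_sub, ← sampleMean_sub]
  congr 1
  ext i
  ring

lemma convexOn_excessLoss {d : ℕ} (n : ℕ) (x : ℕ → Fin d → ℝ) (z : ℕ → ℝ) (p : ℝ) :
    ConvexOn ℝ univ (excessLoss n x z p) := by
  refine ⟨convex_univ, fun b _ c _ s r hs hr hsr => ?_⟩
  simp only [excessLoss, smul_eq_mul, ← sampleMean_const_mul, ← sampleMean_sub, ← sampleMean_add]
  refine sampleMean_mono n fun i => ?_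
  rw [linPred_add, linPred_smul, linPred_smul]
  have e : z i - (s * linPred b (x i) + r * linPred c (x i)) =
      s * (z i - linPred b (x i)) + r * (z i - linPred c (x i)) := by
    linear_combination (-z i) * hsr
  have h : |z i - (s * linPred b (x i) + r * linPred c (x i))| ≤
      s * |z i - linPred b (x i)| + r * |z i - linPred c (x i)| := by
    rw [e]
    refine (abs_add_le _ _).trans ?_
    rw [abs_mul, abs_mul, abs_of_nonneg hs, abs_of_nonneg hr]
  have : |z i| = s * |z i| + r * |z i| := by rw [← add_mul, hsr, one_mul]
  linarith

/-- Estimates are approximate minimisers of the unsmoothed criterion. -/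
lemma IsAQR.excessLoss_le {d : ℕ} {τ : ℝ} (hτ : 0 < τ) {p : ℝ} {n : ℕ} (hn : 0 < n)
    {x : ℕ → Fin d → ℝ} {z : ℕ → ℝ} {c : Fin (d + 1) → ℝ} (h : IsAQR τ p n x z c)
    (b : Fin (d + 1) → ℝ) :
    excessLoss n x z p c ≤ excessLoss n x z p b + 2 * τ := by
  have h1 := abs_le.1 (abs_aqrObjective_sub_le hτ p hn x z c)
  have h2 := abs_le.1 (abs_aqrObjective_sub_le hτ p hn x z b)
  have h3 : aqrObjective τ p n x z c / n ≤ aqrObjective τ p n x z b / n := by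
    gcongr
    exact h b
  rw [excessLoss_eq, excessLoss_eq]
  linarith

/-- Reflection of the responses exchanges the orders `p` and `1 - p`. -/
lemma IsAQR.neg {d : ℕ} {τ p : ℝ} {n : ℕ} {x : ℕ → Fin d → ℝ} {z : ℕ → ℝ}
    {c : Fin (d + 1) → ℝ} (h : IsAQR τ p n x z c) :
    IsAQR τ (1 - p) n x (fun i => -z i) (-c) := by
  have key : ∀ b : Fin (d + 1) → ℝ,
      aqrObjective τ (1 - p) n x (fun i => -z i) (-b) = aqrObjective τ p n x z b := by
    intro b
    unfold aqrObjective
    refine Finset.sum_congr rfl fun i _ => ?_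
    have e : -z i - linPred (-b) (x i) = -(z i - linPred b (x i)) := by rw [linPred_neg]; ring
    rw [e, fSmooth_neg]
    ring
  intro b
  have := h (-b)
  rw [← key c, ← key (-b), neg_neg] at this
  exact this

/-- The criterion is affine in `p`. -/
lemma aqrObjective_sub_order {d : ℕ} (τ p q : ℝ) (n : ℕ) (x : ℕ → Fin d → ℝ) (z : ℕ → ℝ)
    (b : Fin (d + 1) → ℝ) :
    aqrObjective τ p n x z b / n - aqrObjective τ q n x z b / n =
      2 * (p - q) * sampleMean n (fun i => z i - linPred b (x i)) := by
  rw [← sampleMean_const_mul, ← sub_div]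
  unfold aqrObjective sampleMean
  rw [← Finset.sum_sub_distrib]
  congr 1
  refine Finset.sum_congr rfl fun i _ => ?_
  ring

/-- The minimal value `V(p)` of the criterion is concave in `p` with slope twice the mean residual
and `V(0) ≥ -τ`. Summing the resulting increments bounds the accumulated mean residuals of the fits
at the lowest orders by the criterion at order `J / m`. -/
lemma sum_mean_residual_le {d : ℕ} {τ : ℝ} (hτ : 0 < τ) {n : ℕ} (hn : 0 < n)
    {x : ℕ → Fin d → ℝ} {z : ℕ → ℝ} {m : ℕ} {c : ℕ → Fin (d + 1) → ℝ}
    (hc : ∀ j ∈ Ico 1 m, IsAQR τ ((j : ℝ) / m) n x z (c j)) {J : ℕ} (hJ1 : 1 ≤ J) (hJ : J < m) :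
    2 / m * ∑ j ∈ Finset.Icc 1 J, sampleMean n (fun i => z i - linPred (c j) (x i)) ≤
      aqrObjective τ ((J : ℝ) / m) n x z (c J) / n + τ := by
  induction J, hJ1 using Nat.le_induction with
  | base =>
    have h1 := aqrObjective_sub_order τ (((1 : ℕ) : ℝ) / m) 0 n x z (c 1)
    have h2 := (abs_le.1 (abs_aqrObjective_sub_le hτ 0 hn x z (c 1))).1
    have h3 : 0 ≤ sampleMean n (fun i => |z i - linPred (c 1) (x i)| +
        (2 * 0 - 1) * (z i - linPred (c 1) (x i))) := by
      unfold sampleMean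
      refine div_nonneg (Finset.sum_nonneg fun i _ => ?_) (Nat.cast_nonneg n)
      linarith [le_abs_self (z i - linPred (c 1) (x i))]
    have e : 2 * (((1 : ℕ) : ℝ) / m - 0) = 2 / m := by push_cast; ring
    rw [e] at h1
    have h4 := h2.trans (sub_le_self _ h3)
    rw [Finset.Icc_self, Finset.sum_singleton, ← h1]
    linarith
  | succ J hJ1 ih =>
    have ih' := ih (by omega)
    have h1 := aqrObjective_sub_order τ (((J + 1 : ℕ) : ℝ) / m) ((J : ℝ) / m) n x z (c (J + 1))
    have h2 : aqrObjective τ ((J : ℝ) / m) n x z (c J) / n ≤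
        aqrObjective τ ((J : ℝ) / m) n x z (c (J + 1)) / n := by
      gcongr
      exact hc J ⟨hJ1, by omega⟩ _
    have e : 2 * (((J + 1 : ℕ) : ℝ) / m - (J : ℝ) / m) = 2 / m := by push_cast; ring
    rw [e] at h1
    rw [Finset.sum_Icc_succ_top (by omega), mul_add]
    linarith

/-- The mean absolute residual of a fit of order `p ≤ 1/4` exceeds its mean residual by a bounded
amount only. -/
lemma IsAQR.mean_abs_residual_le {d : ℕ} {τ : ℝ} (hτ : 0 < τ) {p : ℝ} (hp0 : 0 ≤ p)
    (hp : p ≤ 1 / 4) {n : ℕ} (hn : 0 < n) {x : ℕ → Fin d → ℝ} {z : ℕ → ℝ}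
    {c : Fin (d + 1) → ℝ} (h : IsAQR τ p n x z c) :
    sampleMean n (fun i => |z i - linPred c (x i)|) ≤
      sampleMean n (fun i => z i - linPred c (x i)) +
        4 * (sampleMean n (fun i => |z i|) + τ) := by
  have h0 := h.excessLoss_le hτ hn 0
  rw [excessLoss_eq, excessLoss_eq] at h0
  have hz : ∀ y : Fin d → ℝ, linPred (0 : Fin (d + 1) → ℝ) y = 0 := fun y => by simp [linPred]
  simp only [hz, sub_zero, sub_self, zero_add] at h0
  rw [sampleMean_add n (fun i => |z i - linPred c (x i)|), sampleMean_const_mul,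
    sampleMean_add n (fun i => |z i|), sampleMean_const_mul] at h0
  set A := sampleMean n (fun i => |z i - linPred c (x i)|) with hA
  set a := sampleMean n (fun i => z i - linPred c (x i)) with ha
  set T := sampleMean n (fun i => |z i|) with hT
  have haA : |a| ≤ A := abs_sampleMean_le n _
  have hzT : |sampleMean n z| ≤ T := abs_sampleMean_le n _
  have hzb := abs_le.1 hzT
  have haA' := abs_le.1 haA
  have hzz : (2 * p - 1) * sampleMean n z ≤ T := by
    nlinarith [hzb.1, hzb.2, abs_nonneg (sampleMean n z)]
  have h1 : A - (1 - 2 * p) * a ≤ 2 * T + 2 * τ := by linarith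
  rcases le_total 0 a with h2 | h2
  · nlinarith
  · nlinarith

/-- Summability of the fits over the lowest orders: if `c₀ ‖b‖` is a lower bound of the mean
absolute linear predictor, the accumulated norms of the fits of order at most `J / m ≤ 1/4` are
controlled by the first absolute moment `T` and by the criterion of the constant predictor `-K`. -/
lemma sum_norm_le_of_isAQR {d : ℕ} {τ : ℝ} (hτ : 0 < τ) {n : ℕ} (hn : 0 < n)
    {x : ℕ → Fin d → ℝ} {z : ℕ → ℝ} {m : ℕ} {c : ℕ → Fin (d + 1) → ℝ}
    (hc : ∀ j ∈ Ico 1 m, IsAQR τ ((j : ℝ) / m) n x z (c j)) {c₀ : ℝ}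
    (hc₀ : ∀ b, c₀ * ‖b‖ ≤ sampleMean n (fun i => |linPred b (x i)|))
    {T : ℝ} (hT : sampleMean n (fun i => |z i|) ≤ T) {K : ℝ} (hK : 0 ≤ K)
    {J : ℕ} (hJ1 : 1 ≤ J) (hJm : J < m) {q : ℝ} (hJq : (J : ℝ) ≤ q * m) (hq : q ≤ 1 / 4) :
    c₀ / m * ∑ j ∈ Finset.Icc 1 J, ‖c j‖ ≤
      sampleMean n (fun i => |z i + K| - (z i + K)) + τ + q * (6 * T + 4 * τ + K) := by
  have hm : (0 : ℝ) < m := by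
    have : 0 < m := by omega
    exact_mod_cast this
  have hJq' : (J : ℝ) / m ≤ q := by rw [div_le_iff₀ hm]; exact hJq
  have hJ0 : 0 ≤ (J : ℝ) / m := by positivity
  have hT0 : 0 ≤ T := by
    refine le_trans ?_ hT
    unfold sampleMean
    positivity
  have hj : ∀ j ∈ Finset.Icc 1 J, c₀ * ‖c j‖ ≤
      sampleMean n (fun i => z i - linPred (c j) (x i)) + (5 * T + 4 * τ) := by
    intro j hj
    rw [Finset.mem_Icc] at hj
    have hjJ : (j : ℝ) / m ≤ (J : ℝ) / m := by
      have : (j : ℝ) ≤ J := by exact_mod_cast hj.2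
      gcongr
    have h1 := (hc j ⟨hj.1, by omega⟩).mean_abs_residual_le hτ (by positivity) (by linarith) hn
    have h2 : sampleMean n (fun i => |linPred (c j) (x i)|) ≤
        sampleMean n (fun i => |z i - linPred (c j) (x i)|) + sampleMean n (fun i => |z i|) := by
      rw [← sampleMean_add]
      refine sampleMean_mono n fun i => ?_
      have := abs_sub_abs_le_abs_sub (linPred (c j) (x i)) (z i)
      rw [abs_sub_comm] at this
      linarith
    linarith [hc₀ (c j)]
  have hsum := Finset.sum_le_sum hj
  rw [← Finset.mul_sum, Finset.sum_add_distrib, Finset.sum_const, Nat.card_Icc,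
    Nat.add_sub_cancel, nsmul_eq_mul] at hsum
  have hres := sum_mean_residual_le hτ hn hc hJ1 hJm
  -- the criterion of order `J / m` at the constant predictor `-K`
  have hV : aqrObjective τ ((J : ℝ) / m) n x z (c J) / n ≤
      sampleMean n (fun i => |z i + K| - (z i + K)) + 2 * ((J : ℝ) / m) * (T + K) + τ := by
    set b : Fin (d + 1) → ℝ := Fin.cons (-K) 0 with hb
    have hbx : ∀ y : Fin d → ℝ, linPred b y = -K := fun y => by simp [linPred, hb]
    have h1 : aqrObjective τ ((J : ℝ) / m) n x z (c J) / n ≤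
        aqrObjective τ ((J : ℝ) / m) n x z b / n := by
      gcongr
      exact hc J ⟨hJ1, hJm⟩ _
    have h2 := abs_le.1 (abs_aqrObjective_sub_le hτ ((J : ℝ) / m) hn x z b)
    simp only [hbx, sub_neg_eq_add] at h2
    have h3 : sampleMean n (fun i => |z i + K| + (2 * ((J : ℝ) / m) - 1) * (z i + K)) =
        sampleMean n (fun i => |z i + K| - (z i + K)) +
          2 * ((J : ℝ) / m) * (sampleMean n z + K) := by
      rw [← sampleMean_const hn K, ← sampleMean_add, ← sampleMean_const_mul, ← sampleMean_add]
      rw [sampleMean_const hn K]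
      congr 1
      ext i
      ring
    have h4 : sampleMean n z ≤ T := (le_abs_self _).trans ((abs_sampleMean_le n _).trans hT)
    have h5 : 2 * ((J : ℝ) / m) * (sampleMean n z + K) ≤ 2 * ((J : ℝ) / m) * (T + K) := by
      gcongr
    linarith
  set s := ∑ j ∈ Finset.Icc 1 J, ‖c j‖
  set r := ∑ j ∈ Finset.Icc 1 J, sampleMean n (fun i => z i - linPred (c j) (x i))
  have e1 : c₀ / m * s = (c₀ * s) / m := by ring
  have e2 : 2 / m * r = 2 * (r / m) := by ring
  have h1 : c₀ / m * s ≤ r / m + (J : ℝ) / m * (5 * T + 4 * τ) := by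
    rw [e1, div_mul_eq_mul_div, ← add_div]
    gcongr
  rw [e2] at hres
  have h2 : (J : ℝ) / m * (6 * T + 4 * τ + K) ≤ q * (6 * T + 4 * τ + K) := by gcongr
  have h3 : 0 ≤ sampleMean n (fun i => |z i + K| - (z i + K)) := by
    unfold sampleMean
    refine div_nonneg (Finset.sum_nonneg fun i _ => ?_) (Nat.cast_nonneg n)
    linarith [le_abs_self (z i + K)]
  nlinarith

/-! ### Isotonic regression -/

/-- One half of the min-max characterisation of isotonic regression: starting from the first index
`s` with `t s = t k`, the values `t j` on `[s, e]` can be lowered simultaneously without destroying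
monotonicity, so that the residuals over `[s, e]` have a nonnegative sum. -/
lemma IsIsotonicRegression.exists_forall_mul_le {m : ℕ} {a t : ℕ → ℝ}
    (h : IsIsotonicRegression m a t) {k : ℕ} (hk : k ∈ Ico 1 m) :
    ∃ s, 1 ≤ s ∧ s ≤ k ∧ ∀ e, k ≤ e → e < m →
      ((e : ℝ) - s + 1) * t k ≤ ∑ j ∈ Finset.Icc s e, a j := by
  classical
  obtain ⟨hmono, hmin⟩ := h
  have hex : ∃ j, 1 ≤ j ∧ t k ≤ t j := ⟨k, hk.1, le_rfl⟩
  set s := Nat.find hex with hs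
  obtain ⟨hs1, hst⟩ : 1 ≤ s ∧ t k ≤ t s := Nat.find_spec hex
  have hsk : s ≤ k := Nat.find_min' hex ⟨hk.1, le_rfl⟩
  have hbefore : ∀ j, 1 ≤ j → j < s → t j < t k := by
    intro j hj1 hjs
    have := Nat.find_min hex hjs
    push Not at this
    exact this hj1
  obtain ⟨ε₀, hε₀, hgap⟩ : ∃ ε₀ > 0, ∀ j, 1 ≤ j → j < s → t j + ε₀ ≤ t k := by
    rcases Nat.lt_or_ge 1 s with h1 | h1
    · refine ⟨t k - t (s - 1), sub_pos.2 (hbefore _ (by omega) (by omega)), fun j hj1 hjs => ?_⟩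
      have := hmono ⟨hj1, by have := hk.2; omega⟩ ⟨by omega, by have := hk.2; omega⟩
        (show j ≤ s - 1 by omega)
      linarith
    · exact ⟨1, one_pos, fun j hj1 hjs => by omega⟩
  refine ⟨s, hs1, hsk, fun e hke hem => ?_⟩
  have hle : ∀ j ∈ Finset.Icc s e, t k ≤ t j := by
    intro j hj
    rw [Finset.mem_Icc] at hj
    exact hst.trans (hmono ⟨hs1, by have := hk.2; omega⟩ ⟨by omega, by omega⟩ hj.1)
  have hcard : ((Finset.Icc s e).card : ℝ) = (e : ℝ) - s + 1 := by
    rw [Nat.card_Icc, Nat.cast_sub (by omega)]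
    push_cast
    ring
  have hsub : Finset.Icc s e ⊆ Finset.Ico 1 m := by
    intro j hj
    rw [Finset.mem_Icc] at hj
    rw [Finset.mem_Ico]
    omega
  have hvar : ∀ ε, 0 < ε → ε ≤ ε₀ →
      2 * ∑ j ∈ Finset.Icc s e, (t j - a j) ≤ ε * ((e : ℝ) - s + 1) := by
    intro ε hε hεε₀
    have h1 := hmin (fun j => if j ∈ Finset.Icc s e then t j - ε else t j) (by
      intro i hi j hj hij
      have ht := hmono hi hj hij
      simp only
      split_ifs with h1 h2 h2
      · linarith
      · linarith
      · rw [Finset.mem_Icc] at h1 h2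
        have := hgap i hi.1 (by omega)
        have := hle j (Finset.mem_Icc.2 h2)
        linarith
      · exact ht)
    rw [← Finset.sum_sdiff hsub, ← Finset.sum_sdiff hsub] at h1
    have h2 : ∑ j ∈ Finset.Ico 1 m \ Finset.Icc s e,
        ((if j ∈ Finset.Icc s e then t j - ε else t j) - a j) ^ 2 =
        ∑ j ∈ Finset.Ico 1 m \ Finset.Icc s e, (t j - a j) ^ 2 :=
      Finset.sum_congr rfl fun j hj => by rw [if_neg (Finset.mem_sdiff.1 hj).2]
    have h3 : ∑ j ∈ Finset.Icc s e, ((if j ∈ Finset.Icc s e then t j - ε else t j) - a j) ^ 2 =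
        ∑ j ∈ Finset.Icc s e, ((t j - a j) ^ 2 - 2 * ε * (t j - a j) + ε ^ 2) :=
      Finset.sum_congr rfl fun j hj => by rw [if_pos hj]; ring
    rw [h2, h3, Finset.sum_add_distrib, Finset.sum_sub_distrib, ← Finset.mul_sum,
      Finset.sum_const, nsmul_eq_mul, hcard] at h1
    have h4 : ε * (2 * ∑ j ∈ Finset.Icc s e, (t j - a j)) ≤ ε * (ε * ((e : ℝ) - s + 1)) := by
      nlinarith
    exact le_of_mul_le_mul_left h4 hε
  have hlen : 0 < (e : ℝ) - s + 1 := by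
    have : (s : ℝ) ≤ e := by exact_mod_cast hsk.trans hke
    linarith
  have hzero : ∑ j ∈ Finset.Icc s e, (t j - a j) ≤ 0 := by
    by_contra hcon
    push Not at hcon
    set S := ∑ j ∈ Finset.Icc s e, (t j - a j)
    have h1 := hvar (min ε₀ (S / ((e : ℝ) - s + 1))) (lt_min hε₀ (by positivity)) (min_le_left _ _)
    have h2 : min ε₀ (S / ((e : ℝ) - s + 1)) * ((e : ℝ) - s + 1) ≤ S := by
      rw [← le_div_iff₀ hlen]
      exact min_le_right _ _
    linarith
  have h5 := Finset.card_nsmul_le_sum _ _ _ hle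
  rw [nsmul_eq_mul, hcard] at h5
  rw [Finset.sum_sub_distrib] at hzero
  linarith

/-- If the data are at most `B` on `(J, e]`, then the isotonic regression at `k ≤ e` exceeds `B` at
most by the mass that the first `J` values can spread over `[k, e]`. -/
lemma IsIsotonicRegression.mul_sub_le {m : ℕ} {a t : ℕ → ℝ} (h : IsIsotonicRegression m a t)
    {k e J : ℕ} (hk : k ∈ Ico 1 m) (hke : k ≤ e) (hem : e < m) {B : ℝ}
    (hB : ∀ j, J < j → j ≤ e → a j ≤ B) :
    ((e : ℝ) - k + 1) * (t k - B) ≤ ∑ j ∈ Finset.Icc 1 J, |a j| + J * |B| := by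
  obtain ⟨s, hs1, hsk, hs⟩ := h.exists_forall_mul_le hk
  have h0 : 0 ≤ ∑ j ∈ Finset.Icc 1 J, |a j| + J * |B| := by positivity
  have hk' : (s : ℝ) ≤ k := by exact_mod_cast hsk
  have he' : (k : ℝ) ≤ e := by exact_mod_cast hke
  rcases le_total (t k) B with htB | htB
  · nlinarith
  have hcard : ((Finset.Icc s e).card : ℝ) = (e : ℝ) - s + 1 := by
    rw [Nat.card_Icc, Nat.cast_sub (by omega)]
    push_cast
    ring
  have h1 : ∑ j ∈ Finset.Icc s e, (a j - B) ≤ ∑ j ∈ Finset.Icc 1 J, (|a j| + |B|) := by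
    calc ∑ j ∈ Finset.Icc s e, (a j - B)
        ≤ ∑ j ∈ (Finset.Icc s e).filter (· ≤ J), (a j - B) := by
          rw [← Finset.sum_filter_add_sum_filter_not (Finset.Icc s e) (· ≤ J)]
          have : ∑ j ∈ (Finset.Icc s e).filter (¬ · ≤ J), (a j - B) ≤ 0 := by
            refine Finset.sum_nonpos fun j hj => ?_
            rw [Finset.mem_filter, Finset.mem_Icc] at hj
            have := hB j (by omega) hj.1.2
            linarith
          linarith
      _ ≤ ∑ j ∈ (Finset.Icc s e).filter (· ≤ J), (|a j| + |B|) := by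
          refine Finset.sum_le_sum fun j _ => ?_
          linarith [le_abs_self (a j), neg_abs_le B]
      _ ≤ _ := by
          refine Finset.sum_le_sum_of_subset_of_nonneg ?_ fun j _ _ => by positivity
          intro j hj
          rw [Finset.mem_filter, Finset.mem_Icc] at hj
          rw [Finset.mem_Icc]
          omega
  rw [Finset.sum_sub_distrib, Finset.sum_const, nsmul_eq_mul, hcard, Finset.sum_add_distrib,
    Finset.sum_const, Nat.card_Icc, Nat.add_sub_cancel, nsmul_eq_mul] at h1
  have h2 := hs e hke hem
  nlinarith

/-- Reflection of data and order of the indices. -/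
lemma IsIsotonicRegression.reflect {m : ℕ} {a t : ℕ → ℝ} (h : IsIsotonicRegression m a t) :
    IsIsotonicRegression m (fun j => -a (m - j)) (fun j => -t (m - j)) := by
  have hmap : ∀ {r : ℕ → ℝ}, MonotoneOn r (Ico 1 m) →
      MonotoneOn (fun j => -r (m - j)) (Ico 1 m) := by
    intro r hr i hi j hj hij
    obtain ⟨hi1, hi2⟩ := hi
    obtain ⟨hj1, hj2⟩ := hj
    exact neg_le_neg (hr ⟨by omega, by omega⟩ ⟨by omega, by omega⟩ (by omega))
  have hsum : ∀ f : ℕ → ℝ, ∑ j ∈ Finset.Ico 1 m, f (m - j) = ∑ j ∈ Finset.Ico 1 m, f j := by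
    intro f
    have := Finset.sum_Ico_reflect f 1 (Nat.le_succ m)
    rw [this]
    congr 1
    simp
  refine ⟨hmap h.1, fun s hs => ?_⟩
  have h1 := h.2 _ (hmap hs)
  rw [← hsum, ← hsum (fun j => (-s (m - j) - a j) ^ 2)] at h1
  refine (le_of_eq ?_).trans (h1.trans (le_of_eq ?_))
  · exact Finset.sum_congr rfl fun j _ => by ring
  · refine Finset.sum_congr rfl fun j hj => ?_
    rw [Finset.mem_Ico] at hj
    rw [show m - (m - j) = j by omega]
    ring

/-- An isotonic regression inherits an upper bound by a nondecreasing continuous curve from its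
data, up to `ε`, provided that the mass of the data at the lowest orders is small. -/
lemma exists_isotonic_le {β : ℝ → ℝ}
    (hmono : ∀ η ∈ Ioo (0 : ℝ) (1 / 2), MonotoneOn β (Icc η (1 - η)))
    (hcont : ∀ η ∈ Ioo (0 : ℝ) (1 / 2), ContinuousOn β (Icc η (1 - η))) {η : ℝ}
    (hη : η ∈ Ioo (0 : ℝ) (1 / 2)) {ε : ℝ} (hε : 0 < ε) :
    ∃ ε' > 0, ∀ η' > 0, η' ≤ ε' → ∀ (m : ℕ) (a t : ℕ → ℝ), IsIsotonicRegression m a t →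
      (∀ j ∈ Ico 1 m, (j : ℝ) / m ∈ Icc η' (1 - η') → a j ≤ β ((j : ℝ) / m) + ε') →
      (∀ J : ℕ, J < m → (J : ℝ) ≤ η' * m → ∑ j ∈ Finset.Icc 1 J, |a j| ≤ ε' * m) →
      ∀ k ∈ Ico 1 m, (k : ℝ) / m ∈ Icc η (1 - η) → t k ≤ β ((k : ℝ) / m) + ε := by
  obtain ⟨hη0, hη1⟩ := hη
  have hη2 : η / 2 ∈ Ioo (0 : ℝ) (1 / 2) := ⟨by linarith, by linarith⟩
  have huc := isCompact_Icc.uniformContinuousOn_of_continuous (hcont _ hη2)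
  rw [Metric.uniformContinuousOn_iff] at huc
  obtain ⟨ρ₀, hρ₀, huc⟩ := huc (ε / 4) (by positivity)
  obtain ⟨C, hC⟩ := (isCompact_Icc.image_of_continuousOn (hcont _ hη2)).isBounded.exists_norm_le
  set ρ := min (ρ₀ / 2) (η / 2) with hρ
  have hρ0 : 0 < ρ := by positivity
  have hC0 : 0 ≤ C := (norm_nonneg _).trans
    (hC _ ⟨1 / 2, ⟨by linarith, by linarith⟩, rfl⟩)
  set ε' := min (min (ε / 4) (η / 2)) (ρ * ε / (4 * (1 + C + ε))) with hε'
  have h1 : ε' ≤ ε / 4 := (min_le_left _ _).trans (min_le_left _ _)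
  have h2 : ε' ≤ η / 2 := (min_le_left _ _).trans (min_le_right _ _)
  have h3 : ε' * (1 + C + ε) ≤ ρ * ε / 4 := by
    have h : ε' ≤ ρ * ε / 4 / (1 + C + ε) := by
      rw [div_div]; exact min_le_right _ _
    rwa [le_div_iff₀ (by positivity)] at h
  have hε'0 : 0 < ε' := by positivity
  refine ⟨ε', hε'0, fun η' hη'0 hη' m a t hiso ha hedge k hk hkη => ?_⟩
  have hm : (0 : ℝ) < m := by
    have : 0 < m := by have := hk.1; have := hk.2; omega
    exact_mod_cast this
  -- averages over blocks that extend from below `k` up to `e`, where `e / m - k / m ≈ ρ`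
  set e := k + ⌊ρ * m⌋₊ with he
  have hfl : (⌊ρ * m⌋₊ : ℝ) ≤ ρ * m := Nat.floor_le (by positivity)
  have hfl' : ρ * m < (⌊ρ * m⌋₊ : ℝ) + 1 := Nat.lt_floor_add_one _
  have hkm : (k : ℝ) ≤ (1 - η) * m := by rw [← div_le_iff₀ hm]; exact hkη.2
  have hkm' : η * m ≤ k := by rw [← le_div_iff₀ hm]; exact hkη.1
  have hρη : ρ ≤ η / 2 := min_le_right _ _
  have hρρ₀ : ρ ≤ ρ₀ / 2 := min_le_left _ _
  have heR : (e : ℝ) = k + (⌊ρ * m⌋₊ : ℝ) := by rw [he]; push_cast; ring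
  have hem1 : (e : ℝ) ≤ (1 - η / 2) * m := by
    rw [heR]; nlinarith
  have hem : e < m := by
    have : (e : ℝ) < m := by nlinarith
    exact_mod_cast this
  have hke : k ≤ e := Nat.le_add_right _ _
  have hkeR : (k : ℝ) ≤ e := by exact_mod_cast hke
  have hp_k : (k : ℝ) / m ∈ Icc (η / 2) (1 - η / 2) := ⟨by linarith [hkη.1], by linarith [hkη.2]⟩
  have hp_e : (e : ℝ) / m ∈ Icc (η / 2) (1 - η / 2) := by
    refine ⟨hp_k.1.trans (by gcongr), by rw [div_le_iff₀ hm]; exact hem1⟩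
  have hclose : β ((e : ℝ) / m) ≤ β ((k : ℝ) / m) + ε / 4 := by
    have hd : dist ((e : ℝ) / m) ((k : ℝ) / m) < ρ₀ := by
      rw [Real.dist_eq, ← sub_div, heR, add_sub_cancel_left, abs_of_nonneg (by positivity),
        div_lt_iff₀ hm]
      nlinarith
    have := huc _ hp_e _ hp_k hd
    rw [Real.dist_eq, abs_lt] at this
    linarith [this.2]
  set B := β ((k : ℝ) / m) + ε / 2 with hBdef
  set J := ⌊η' * m⌋₊ with hJ
  have hJle : (J : ℝ) ≤ η' * m := Nat.floor_le (by positivity)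
  have hJm : J < m := by
    have : (J : ℝ) < m := by nlinarith
    exact_mod_cast this
  have hη'2 : η' ≤ η / 2 := hη'.trans h2
  have hB : ∀ j, J < j → j ≤ e → a j ≤ B := by
    intro j hJj hje
    have hjm : η' * m < j := (Nat.floor_lt (by positivity)).1 hJj
    have hjeR : (j : ℝ) ≤ e := by exact_mod_cast hje
    have hj1 : η' ≤ (j : ℝ) / m := by rw [le_div_iff₀ hm]; exact hjm.le
    have hj2 : (j : ℝ) / m ≤ (e : ℝ) / m := by gcongr
    have hη'mem : η' ∈ Ioo (0 : ℝ) (1 / 2) := ⟨hη'0, by linarith⟩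
    have h5 := ha j ⟨by omega, by omega⟩ ⟨hj1, by linarith [hp_e.2]⟩
    have h6 := hmono η' hη'mem ⟨hj1, by linarith [hp_e.2]⟩
      ⟨by linarith [hp_e.1], by linarith [hp_e.2]⟩ hj2
    linarith
  have h7 := hiso.mul_sub_le hk hke hem hB
  have h8 := hedge J hJm hJle
  have hBC : |B| ≤ C + ε := by
    have := hC _ ⟨_, hp_k, rfl⟩
    rw [Real.norm_eq_abs] at this
    rw [abs_le] at this ⊢
    constructor <;> linarith [this.1, this.2]
  have h9 : (J : ℝ) * |B| ≤ ε' * m * (C + ε) := by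
    have : (J : ℝ) ≤ ε' * m := hJle.trans (by gcongr)
    gcongr
  have hρe : ρ * m ≤ (e : ℝ) - k + 1 := by rw [heR]; linarith
  by_contra hcon
  push Not at hcon
  have h10 : ε / 2 < t k - B := by linarith
  have h11 : ρ * m * (ε / 2) < ((e : ℝ) - k + 1) * (t k - B) := by
    have : 0 < ρ * m := by positivity
    calc ρ * m * (ε / 2) < ρ * m * (t k - B) := by gcongr
      _ ≤ _ := by
        have : 0 ≤ t k - B := by linarith
        gcongr
  have h12 : ρ * m * (ε / 2) < ε' * (1 + C + ε) * m := by linarith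
  have h13 : ε' * (1 + C + ε) * m ≤ ρ * ε / 4 * m := by gcongr
  have : 0 < ρ * m * ε := by positivity
  linarith

/-- Isotonic regressions of data close to a nondecreasing continuous curve are close to the curve,
provided that the mass of the data at the extreme orders is small. -/
lemma exists_isotonic_close {β : ℝ → ℝ}
    (hmono : ∀ η ∈ Ioo (0 : ℝ) (1 / 2), MonotoneOn β (Icc η (1 - η)))
    (hcont : ∀ η ∈ Ioo (0 : ℝ) (1 / 2), ContinuousOn β (Icc η (1 - η))) {η : ℝ}
    (hη : η ∈ Ioo (0 : ℝ) (1 / 2)) {ε : ℝ} (hε : 0 < ε) :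
    ∃ ε' > 0, ∀ η' > 0, η' ≤ ε' → ∀ (m : ℕ) (a t : ℕ → ℝ), IsIsotonicRegression m a t →
      (∀ j ∈ Ico 1 m, (j : ℝ) / m ∈ Icc η' (1 - η') → |a j - β ((j : ℝ) / m)| ≤ ε') →
      (∀ J : ℕ, J < m → (J : ℝ) ≤ η' * m → ∑ j ∈ Finset.Icc 1 J, |a j| ≤ ε' * m) →
      (∀ J : ℕ, J < m → (J : ℝ) ≤ η' * m → ∑ j ∈ Finset.Icc 1 J, |a (m - j)| ≤ ε' * m) →
      ∀ k ∈ Ico 1 m, (k : ℝ) / m ∈ Icc η (1 - η) → |t k - β ((k : ℝ) / m)| ≤ ε := by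
  have hrefl : ∀ {r p : ℝ}, p ∈ Icc r (1 - r) → 1 - p ∈ Icc r (1 - r) := fun hp =>
    ⟨by linarith [hp.2], by linarith [hp.1]⟩
  obtain ⟨ε₁, hε₁, h₁⟩ := exists_isotonic_le hmono hcont hη hε
  obtain ⟨ε₂, hε₂, h₂⟩ := exists_isotonic_le (β := fun p => -β (1 - p))
    (fun r hr p hp q hq hpq => neg_le_neg
      (hmono r hr (hrefl hq) (hrefl hp) (by linarith)))
    (fun r hr => ((hcont r hr).comp (by fun_prop) fun p hp => hrefl hp).neg) hη hε
  refine ⟨min ε₁ ε₂, lt_min hε₁ hε₂, fun η' hη' hle m a t hiso ha hlow hup k hk hkη => ?_⟩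
  have hm : (0 : ℝ) < m := by
    have : 0 < m := by have := hk.1; have := hk.2; omega
    exact_mod_cast this
  have hdiv : ∀ j ∈ Ico 1 m, (((m - j : ℕ) : ℝ)) / m = 1 - (j : ℝ) / m := by
    intro j hj
    rw [Nat.cast_sub hj.2.le]
    field_simp
  have hmem : ∀ j ∈ Ico 1 m, m - j ∈ Ico 1 m := by
    rintro j ⟨hj1, hj2⟩
    exact ⟨by omega, by omega⟩
  have e₁ : min ε₁ ε₂ ≤ ε₁ := min_le_left _ _
  have e₂ : min ε₁ ε₂ ≤ ε₂ := min_le_right _ _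
  have u := h₁ η' hη' (hle.trans e₁) m a t hiso
    (fun j hj hjη => by have := (abs_le.1 (ha j hj hjη)).2; linarith)
    (fun J hJ hJη => (hlow J hJ hJη).trans (by gcongr)) k hk hkη
  have l := h₂ η' hη' (hle.trans e₂) m _ _ hiso.reflect
    (fun j hj hjη => by
      have h := (abs_le.1 (ha (m - j) (hmem j hj) (by rw [hdiv j hj]; exact hrefl hjη))).1
      rw [hdiv j hj] at h
      linarith)
    (fun J hJ hJη => by
      simp only [abs_neg]
      exact (hup J hJ hJη).trans (by gcongr))
    (m - k) (hmem k hk) (by rw [hdiv k hk]; exact hrefl hkη)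
  rw [hdiv k hk, show m - (m - k) = k by have := hk.2; omega, sub_sub_cancel] at l
  rw [abs_le]
  constructor <;> linarith

/-! ### Linear interpolation -/

/-- On fine grids, closeness to a continuous curve at the grid points carries over to the linear
interpolant. -/
lemma exists_linInterp_close {β : ℝ → ℝ} {η : ℝ} (hη : η ∈ Ioo (0 : ℝ) (1 / 2))
    (hcont : ContinuousOn β (Icc (η / 2) (1 - η / 2))) {ε : ℝ} (hε : 0 < ε) :
    ∃ m₀ : ℕ, ∀ m ≥ m₀, ∀ v : ℕ → ℝ,
      (∀ j ∈ Ico 1 m, (j : ℝ) / m ∈ Icc (η / 2) (1 - η / 2) →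
        |v j - β ((j : ℝ) / m)| ≤ ε / 2) →
      ∀ p ∈ Icc η (1 - η), |linInterp m v p - β p| ≤ ε := by
  obtain ⟨hη0, hη1⟩ := hη
  have huc := isCompact_Icc.uniformContinuousOn_of_continuous hcont
  rw [Metric.uniformContinuousOn_iff] at huc
  obtain ⟨ρ, hρ, huc⟩ := huc (ε / 2) (by positivity)
  set r := min ρ (η / 2) with hr
  have hr0 : 0 < r := by positivity
  obtain ⟨m₀, hm₀⟩ := exists_nat_gt (1 / r)
  refine ⟨m₀, fun m hm v hv p hp => ?_⟩
  have hm1 : 1 / r < m := hm₀.trans_le (by exact_mod_cast hm)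
  have hmpos : (0 : ℝ) < m := lt_trans (by positivity) hm1
  have hmr : 1 < r * m := by
    rw [div_lt_iff₀ hr0] at hm1
    linarith
  have hrρ : r ≤ ρ := min_le_left _ _
  have hrη : r ≤ η / 2 := min_le_right _ _
  have hp0 : 0 < p := hη0.trans_le hp.1
  set j := ⌊p * m⌋₊ with hj
  have hj1 : (j : ℝ) ≤ p * m := Nat.floor_le (by positivity)
  have hj2 : p * m < (j : ℝ) + 1 := Nat.lt_floor_add_one _
  have hpm : η * m ≤ p * m := by have := hp.1; gcongr
  have hpm' : p * m ≤ (1 - η) * m := by have := hp.2; gcongr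
  have hrm : r * m ≤ η / 2 * m := by gcongr
  have hjpos : 0 < j := by
    have : (0 : ℝ) < j := by nlinarith
    exact_mod_cast this
  have hjm : j + 1 < m := by
    have : ((j + 1 : ℕ) : ℝ) < m := by push_cast; nlinarith
    exact_mod_cast this
  have hnode : ∀ i : ℕ, (i = j ∨ i = j + 1) → |v i - β p| ≤ ε := by
    intro i hi
    have hi1 : p * m - 1 ≤ i ∧ (i : ℝ) ≤ p * m + 1 := by
      rcases hi with rfl | rfl
      · constructor <;> linarith
      · push_cast; constructor <;> linarith
    have hiI : (i : ℝ) / m ∈ Icc (η / 2) (1 - η / 2) := by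
      rw [mem_Icc, le_div_iff₀ hmpos, div_le_iff₀ hmpos]
      constructor <;> nlinarith
    have hd : dist ((i : ℝ) / m) p < ρ := by
      have e : (i : ℝ) / m - p = (i - p * m) / m := by field_simp
      rw [Real.dist_eq, e, abs_div, abs_of_pos hmpos, div_lt_iff₀ hmpos]
      have h1 : |(i : ℝ) - p * m| ≤ 1 := by rw [abs_le]; constructor <;> linarith
      have : r * m ≤ ρ * m := by gcongr
      linarith
    have h2 := huc _ hiI p ⟨by linarith [hp.1], by linarith [hp.2]⟩ hd
    rw [Real.dist_eq] at h2
    have h3 := hv i (by rw [mem_Ico]; omega) hiI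
    calc |v i - β p| ≤ |v i - β ((i : ℝ) / m)| + |β ((i : ℝ) / m) - β p| := abs_sub_le _ _ _
      _ ≤ ε := by linarith
  have ha := abs_le.1 (hnode j (Or.inl rfl))
  have hb := abs_le.1 (hnode (j + 1) (Or.inr rfl))
  -- the interpolant is a convex combination of the values at the two adjacent nodes
  set s := p * m - j with hs
  have e : linInterp m v p = (1 - s) * v j + s * v (j + 1) := by
    simp only [linInterp, ← hj]
    rw [hs]
    field_simp
    ring
  have hs0 : 0 ≤ s := by linarith
  have hs1 : s ≤ 1 := by linarith
  rw [e, abs_le]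
  constructor <;> nlinarith [ha.1, ha.2, hb.1, hb.2]

lemma measurable_linInterp (m : ℕ) (v : ℕ → ℝ) : Measurable (linInterp m v) := by
  have hfl : Measurable fun p : ℝ => ⌊p * m⌋₊ := Nat.measurable_floor.comp (by fun_prop)
  have h : ∀ w : ℕ → ℝ, Measurable fun p : ℝ => w ⌊p * m⌋₊ := fun w =>
    (measurable_of_countable w).comp hfl
  exact (h v).add ((measurable_id.sub (h fun j => (j : ℝ) / m)).mul
    (h fun j => (v (j + 1) - v j) / (((j : ℝ) + 1) / m - (j : ℝ) / m)))

/-! ### Events of high probability -/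

/-- The property `P a` holds with (inner) probability tending to `1` along `l`: the outer measure of
its failure tends to `0`. -/
def HighProb {Ω ι : Type*} [MeasurableSpace Ω] (μ : Measure Ω) (l : Filter ι)
    (P : ι → Ω → Prop) : Prop :=
  Tendsto (fun a => μ {ω | ¬ P a ω}) l (𝓝 0)

section HighProb

variable {Ω ι : Type*} [MeasurableSpace Ω] {μ : Measure Ω} {l : Filter ι} {P Q : ι → Ω → Prop}

lemma HighProb.mono_eventually (hP : HighProb μ l P) (h : ∀ᶠ a in l, ∀ ω, P a ω → Q a ω) :
    HighProb μ l Q := by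
  refine tendsto_of_tendsto_of_tendsto_of_le_of_le' tendsto_const_nhds hP
    (Eventually.of_forall fun _ => zero_le) ?_
  filter_upwards [h] with a ha
  exact measure_mono fun ω hω hPω => hω (ha ω hPω)

lemma HighProb.mono (hP : HighProb μ l P) (h : ∀ a ω, P a ω → Q a ω) : HighProb μ l Q :=
  hP.mono_eventually (Eventually.of_forall h)

lemma HighProb.and (hP : HighProb μ l P) (hQ : HighProb μ l Q) :
    HighProb μ l fun a ω => P a ω ∧ Q a ω := by
  have h := hP.add hQ
  rw [add_zero] at h
  refine tendsto_of_tendsto_of_tendsto_of_le_of_le tendsto_const_nhds h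
    (fun _ => zero_le) fun a => (measure_mono fun ω hω => ?_).trans (measure_union_le _ _)
  by_cases hPω : P a ω
  · exact Or.inr fun hQω => hω ⟨hPω, hQω⟩
  · exact Or.inl hPω

lemma highProb_of_forall (h : ∀ a ω, P a ω) : HighProb μ l P := by
  have : (fun a => μ {ω | ¬ P a ω}) = fun _ => 0 := by
    ext a
    simp [h]
  rw [HighProb, this]
  exact tendsto_const_nhds

lemma HighProb.finset_forall {α : Type*} (s : Finset α) {R : α → ι → Ω → Prop}
    (h : ∀ i ∈ s, HighProb μ l (R i)) : HighProb μ l fun a ω => ∀ i ∈ s, R i a ω := by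
  classical
  induction s using Finset.induction_on with
  | empty => exact highProb_of_forall fun a ω i hi => by simp at hi
  | insert i s _ ih =>
    refine ((h i (by simp)).and (ih fun j hj => h j (by simp [hj]))).mono fun a ω hω j hj => ?_
    rcases Finset.mem_insert.1 hj with rfl | hj
    · exact hω.1
    · exact hω.2 j hj

lemma HighProb.comp {ι' : Type*} {l' : Filter ι'} {f : ι' → ι} (hP : HighProb μ l P)
    (hf : Tendsto f l' l) : HighProb μ l' fun a ω => P (f a) ω :=
  Tendsto.comp (g := fun a => μ {ω | ¬ P a ω}) hP hf

/-- Over a probability space and a proper filter, events of high probability occur. -/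
lemma HighProb.exists [l.NeBot] [IsProbabilityMeasure μ] (hP : HighProb μ l P) :
    ∃ a ω, P a ω := by
  by_contra h
  push Not at h
  have : (fun a => μ {ω | ¬ P a ω}) = fun _ => 1 := by
    ext a
    have : {ω | ¬ P a ω} = univ := by ext ω; simp [h a ω]
    rw [this, measure_univ]
  rw [HighProb, this] at hP
  exact one_ne_zero (tendsto_nhds_unique hP tendsto_const_nhds).symm

end HighProb

lemma MeasureTheory.TendstoInMeasure.highProb {Ω ι : Type*} [MeasurableSpace Ω] {μ : Measure Ω}
    {l : Filter ι} {f : ι → Ω → ℝ} {g : Ω → ℝ} (h : TendstoInMeasure μ f l g) {ε : ℝ}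
    (hε : 0 < ε) : HighProb μ l fun a ω => |f a ω - g ω| < ε := by
  have := tendstoInMeasure_iff_dist.1 h ε hε
  simpa [HighProb, Real.dist_eq, not_lt] using this

lemma tendstoInMeasure_of_highProb {Ω ι : Type*} [MeasurableSpace Ω] {μ : Measure Ω}
    {l : Filter ι} {f : ι → Ω → ℝ} {g : Ω → ℝ}
    (h : ∀ ε, 0 < ε → HighProb μ l fun a ω => |f a ω - g ω| ≤ ε) : TendstoInMeasure μ f l g := by
  refine tendstoInMeasure_iff_dist.2 fun ε hε => ?_
  have := (h (ε / 2) (by positivity)).mono (Q := fun a ω => ¬ ε ≤ dist (f a ω) (g ω))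
    fun a ω hω => by rw [Real.dist_eq]; linarith
  simpa [HighProb] using this

lemma tendstoInProbUniformlyOn_iff {Ω ι : Type*} [MeasurableSpace Ω] {μ : Measure Ω}
    {F : ι → Ω → ℝ → ℝ} {G : ℝ → ℝ} {l : Filter ι} {s : Set ℝ} :
    TendstoInProbUniformlyOn μ F G l s ↔
      ∀ ε, 0 < ε → HighProb μ l fun a ω => ∀ p ∈ s, |F a ω p - G p| ≤ ε := by
  simp only [TendstoInProbUniformlyOn, HighProb]
  push Not
  rfl

/-! ### Laws of large numbers -/

lemma abs_integral_sub_le_of_lipschitz {Ω Θ : Type*} [MeasurableSpace Ω] {μ : Measure Ω}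
    [PseudoMetricSpace Θ] {φ : Θ → Ω → ℝ} {g : Ω → ℝ} (hφ : ∀ θ, Integrable (φ θ) μ)
    (hg : Integrable g μ) (h : ∀ θ θ' ω, |φ θ ω - φ θ' ω| ≤ dist θ θ' * g ω) (θ θ' : Θ) :
    |(∫ ω, φ θ ω ∂μ) - ∫ ω, φ θ' ω ∂μ| ≤ dist θ θ' * ∫ ω, g ω ∂μ := by
  rw [← integral_sub (hφ θ) (hφ θ'), ← integral_const_mul]
  exact abs_integral_le_integral_abs.trans
    (integral_mono ((hφ θ).sub (hφ θ')).abs (hg.const_mul _) fun ω => h θ θ' ω)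

lemma continuous_integral_of_lipschitz {Ω Θ : Type*} [MeasurableSpace Ω] {μ : Measure Ω}
    [PseudoMetricSpace Θ] {φ : Θ → Ω → ℝ} {g : Ω → ℝ} (hφ : ∀ θ, Integrable (φ θ) μ)
    (hg : Integrable g μ) (h : ∀ θ θ' ω, |φ θ ω - φ θ' ω| ≤ dist θ θ' * g ω) :
    Continuous fun θ => ∫ ω, φ θ ω ∂μ := by
  refine (LipschitzWith.of_dist_le_mul (K := (∫ ω, g ω ∂μ).toNNReal) fun θ θ' => ?_).continuous
  rw [Real.dist_eq, mul_comm]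
  refine (abs_integral_sub_le_of_lipschitz hφ hg h θ θ').trans ?_
  gcongr
  exact Real.le_coe_toNNReal _

/-- `(Xs i, Zs i)` are independent copies of `(X, Z)`. -/
structure IsIIDCopies {Ω : Type*} [MeasurableSpace Ω] (μ : Measure Ω) {d : ℕ}
    (X : Ω → Fin d → ℝ) (Z : Ω → ℝ) (Xs : ℕ → Ω → Fin d → ℝ) (Zs : ℕ → Ω → ℝ) : Prop where
  measurable_X : Measurable X
  measurable_Z : Measurable Z
  measurable_Xs : ∀ i, Measurable (Xs i)
  measurable_Zs : ∀ i, Measurable (Zs i)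
  indep : iIndepFun (fun i ω => (Xs i ω, Zs i ω)) μ
  ident : ∀ i, IdentDistrib (fun ω => (Xs i ω, Zs i ω)) (fun ω => (X ω, Z ω)) μ μ

section LLN

variable {Ω : Type*} [MeasurableSpace Ω] {μ : Measure Ω} {d : ℕ}
  {X : Ω → Fin d → ℝ} {Z : Ω → ℝ} {Xs : ℕ → Ω → Fin d → ℝ} {Zs : ℕ → Ω → ℝ}

lemma IsIIDCopies.comp (h : IsIIDCopies μ X Z Xs Zs) {g : ℝ → ℝ} (hg : Measurable g) :
    IsIIDCopies μ X (fun ω => g (Z ω)) Xs (fun i ω => g (Zs i ω)) where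
  measurable_X := h.measurable_X
  measurable_Z := hg.comp h.measurable_Z
  measurable_Xs := h.measurable_Xs
  measurable_Zs i := hg.comp (h.measurable_Zs i)
  indep := h.indep.comp (fun _ w => (w.1, g w.2)) fun _ => by fun_prop
  ident i := (h.ident i).comp (u := fun w : (Fin d → ℝ) × ℝ => (w.1, g w.2)) (by fun_prop)

variable [IsProbabilityMeasure μ]

lemma IsIIDCopies.highProb_mean (h : IsIIDCopies μ X Z Xs Zs) {φ : (Fin d → ℝ) × ℝ → ℝ}
    (hφ : Measurable φ) (hint : Integrable (fun ω => φ (X ω, Z ω)) μ) {ε : ℝ} (hε : 0 < ε) :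
    HighProb μ atTop fun (n : ℕ) ω =>
      |sampleMean n (fun i => φ (Xs i ω, Zs i ω)) - ∫ ω, φ (X ω, Z ω) ∂μ| < ε := by
  have hid : ∀ i, IdentDistrib (fun ω => φ (Xs i ω, Zs i ω)) (fun ω => φ (X ω, Z ω)) μ μ :=
    fun i => (h.ident i).comp hφ
  have hmeas : ∀ i, Measurable fun ω => φ (Xs i ω, Zs i ω) := fun i =>
    hφ.comp ((h.measurable_Xs i).prodMk (h.measurable_Zs i))
  have hlln := strong_law_ae_real (fun i ω => φ (Xs i ω, Zs i ω))
    ((hid 0).integrable_iff.2 hint)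
    (fun i j hij => (h.indep.indepFun hij).comp hφ hφ)
    (fun i => (hid i).trans (hid 0).symm)
  rw [(hid 0).integral_eq] at hlln
  refine TendstoInMeasure.highProb (g := fun _ => ∫ ω, φ (X ω, Z ω) ∂μ)
    (tendstoInMeasure_of_tendsto_ae (fun n => ?_) hlln) hε
  exact ((Finset.measurable_sum _ fun i _ => hmeas i).div_const _).aestronglyMeasurable

/-- A uniform law of large numbers over a compact set of parameters, for integrands that are
Lipschitz in the parameter with an integrable constant. -/
lemma IsIIDCopies.highProb_mean_uniform (h : IsIIDCopies μ X Z Xs Zs) {Θ : Type*}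
    [PseudoMetricSpace Θ] {K : Set Θ} (hK : IsCompact K) {φ : Θ → (Fin d → ℝ) × ℝ → ℝ}
    (hφ : ∀ θ, Measurable (φ θ)) (hint : ∀ θ, Integrable (fun ω => φ θ (X ω, Z ω)) μ)
    {g : (Fin d → ℝ) × ℝ → ℝ} (hg : Measurable g) (hgint : Integrable (fun ω => g (X ω, Z ω)) μ)
    (hg0 : ∀ w, 0 ≤ g w) (hlip : ∀ θ θ' w, |φ θ w - φ θ' w| ≤ dist θ θ' * g w)
    {ε : ℝ} (hε : 0 < ε) :
    HighProb μ atTop fun (n : ℕ) ω => ∀ θ ∈ K,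
      |sampleMean n (fun i => φ θ (Xs i ω, Zs i ω)) - ∫ ω, φ θ (X ω, Z ω) ∂μ| ≤ ε := by
  set L := ∫ ω, g (X ω, Z ω) ∂μ with hL
  have hL0 : 0 ≤ L := integral_nonneg fun ω => hg0 _
  set r := ε / (3 * (L + 1)) with hr
  have hr0 : 0 < r := by positivity
  have hrL : r * (L + 1) = ε / 3 := by rw [hr]; field_simp
  obtain ⟨t, -, htfin, htcov⟩ := hK.finite_cover_balls hr0
  have h1 := HighProb.finset_forall htfin.toFinset fun θ _ =>
    h.highProb_mean (hφ θ) (hint θ) (show 0 < ε / 3 by positivity)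
  refine (h1.and (h.highProb_mean hg hgint one_pos)).mono fun n ω hω θ hθ => ?_
  obtain ⟨hnet, hgm⟩ := hω
  obtain ⟨θ', hθ't, hθ'⟩ := mem_iUnion₂.1 (htcov hθ)
  rw [Metric.mem_ball] at hθ'
  have hnet' := abs_lt.1 (hnet θ' (htfin.mem_toFinset.2 hθ't))
  have hA : |sampleMean n (fun i => φ θ (Xs i ω, Zs i ω)) -
      sampleMean n (fun i => φ θ' (Xs i ω, Zs i ω))| ≤ ε / 3 := by
    rw [← sampleMean_sub]
    refine (abs_sampleMean_le _ _).trans ((sampleMean_mono n fun i => hlip θ θ' _).trans ?_)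
    rw [sampleMean_const_mul, ← hrL]
    have h2 : sampleMean n (fun i => g (Xs i ω, Zs i ω)) ≤ L + 1 := by
      linarith [(abs_lt.1 hgm).2]
    calc dist θ θ' * sampleMean n (fun i => g (Xs i ω, Zs i ω)) ≤ dist θ θ' * (L + 1) := by gcongr
      _ ≤ r * (L + 1) := by gcongr
  have hB : |(∫ ω, φ θ (X ω, Z ω) ∂μ) - ∫ ω, φ θ' (X ω, Z ω) ∂μ| ≤ ε / 3 := by
    refine (abs_integral_sub_le_of_lipschitz (φ := fun θ ω => φ θ (X ω, Z ω)) hint hgint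
      (fun θ θ' ω => hlip θ θ' _) θ θ').trans ?_
    rw [← hrL]
    gcongr
    linarith
  have hA' := abs_le.1 hA
  have hB' := abs_le.1 hB
  rw [abs_le]
  constructor <;> linarith

/-- If averages of independent copies of a nonnegative variable are bounded with high probability,
the variable is integrable: its truncations have bounded means by the law of large numbers. -/
lemma IsIIDCopies.integrable_of_highProb (h : IsIIDCopies μ X Z Xs Zs)
    {φ : (Fin d → ℝ) × ℝ → ℝ} (hφ : Measurable φ) (hφ0 : ∀ w, 0 ≤ φ w) {C : ℝ}
    (hC : HighProb μ atTop fun (n : ℕ) ω => sampleMean n (fun i => φ (Xs i ω, Zs i ω)) ≤ C) :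
    Integrable (fun ω => φ (X ω, Z ω)) μ := by
  have hmeas : Measurable fun ω => φ (X ω, Z ω) :=
    hφ.comp (h.measurable_X.prodMk h.measurable_Z)
  have hint : ∀ M : ℕ, Integrable (fun ω => min (φ (X ω, Z ω)) (M : ℝ)) μ := fun M =>
    Integrable.of_bound (hmeas.min measurable_const).aestronglyMeasurable (M : ℝ)
      (Eventually.of_forall fun ω => by
        rw [Real.norm_of_nonneg (le_min (hφ0 _) (Nat.cast_nonneg M))]
        exact min_le_right _ _)
  have hbd : ∀ M : ℕ, ∫ ω, min (φ (X ω, Z ω)) (M : ℝ) ∂μ ≤ C + 1 := by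
    intro M
    obtain ⟨n, ω, h1, h2⟩ := (hC.and (h.highProb_mean (φ := fun w => min (φ w) (M : ℝ))
      (hφ.min measurable_const) (hint M) one_pos)).exists
    have h3 : sampleMean n (fun i => min (φ (Xs i ω, Zs i ω)) (M : ℝ)) ≤
        sampleMean n (fun i => φ (Xs i ω, Zs i ω)) := sampleMean_mono n fun i => min_le_left _ _
    linarith [(abs_lt.1 h2).1]
  refine ⟨hmeas.aestronglyMeasurable, ?_⟩
  rw [hasFiniteIntegral_iff_ofReal (Eventually.of_forall fun ω => hφ0 _)]
  have hlim : ∀ ω, Tendsto (fun M : ℕ => ENNReal.ofReal (min (φ (X ω, Z ω)) (M : ℝ))) atTop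
      (𝓝 (ENNReal.ofReal (φ (X ω, Z ω)))) := by
    intro ω
    refine tendsto_const_nhds.congr' ?_
    filter_upwards [eventually_ge_atTop ⌈φ (X ω, Z ω)⌉₊] with M hM
    rw [min_eq_left (Nat.ceil_le.1 hM)]
  calc ∫⁻ ω, ENNReal.ofReal (φ (X ω, Z ω)) ∂μ
      = ∫⁻ ω, liminf (fun M : ℕ => ENNReal.ofReal (min (φ (X ω, Z ω)) (M : ℝ))) atTop ∂μ :=
        lintegral_congr fun ω => (hlim ω).liminf_eq.symm
    _ ≤ liminf (fun M : ℕ => ∫⁻ ω, ENNReal.ofReal (min (φ (X ω, Z ω)) (M : ℝ)) ∂μ) atTop :=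
        lintegral_liminf_le fun M => (hmeas.min measurable_const).ennreal_ofReal
    _ ≤ liminf (fun _ : ℕ => ENNReal.ofReal (C + 1)) atTop := by
        refine liminf_le_liminf (Eventually.of_forall fun M => ?_)
        rw [← ofReal_integral_eq_lintegral_ofReal (hint M)
          (Eventually.of_forall fun ω => le_min (hφ0 _) (Nat.cast_nonneg M))]
        exact ENNReal.ofReal_le_ofReal (hbd M)
    _ = ENNReal.ofReal (C + 1) := liminf_const _
    _ < ⊤ := ENNReal.ofReal_lt_top

/-- Convergence of the normalised Gram matrices makes the covariates integrable. -/
lemma IsIIDCopies.integrable_designNorm (h : IsIIDCopies μ X Z Xs Zs)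
    (hA : DesignConvergence μ Xs) : Integrable (fun ω => designNorm (X ω)) μ := by
  obtain ⟨A, -, hA⟩ := hA
  unfold designNorm
  refine (integrable_const 1).add (integrable_finsetSum _ fun k _ => ?_)
  have hsq : Integrable (fun ω => X ω k ^ 2) μ := by
    refine h.integrable_of_highProb (φ := fun w => w.1 k ^ 2) (C := A k.succ k.succ + 1)
      (by fun_prop) (fun w => sq_nonneg _) ?_
    refine ((hA k.succ k.succ).highProb one_pos).mono fun n ω hω => ?_
    have e : ((1 / (n : ℝ)) • ((designMatrix n (fun i => Xs i ω)).transpose *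
        designMatrix n (fun i => Xs i ω))) k.succ k.succ =
        sampleMean n (fun i => Xs i ω k ^ 2) := by
      simp only [Matrix.smul_apply, Matrix.mul_apply, Matrix.transpose_apply, designMatrix,
        Matrix.of_apply, Fin.cons_succ, smul_eq_mul, sampleMean]
      rw [Fin.sum_univ_eq_sum_range (fun i => Xs i ω k * Xs i ω k) n]
      simp only [sq]
      ring
    rw [e] at hω
    linarith [(abs_lt.1 hω).2]
  have hXk : Measurable fun ω => X ω k := (measurable_pi_apply k).comp h.measurable_X
  refine ((integrable_const 1).add hsq).mono' hXk.abs.aestronglyMeasurable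
    (Eventually.of_forall fun ω => ?_)
  simp only [Pi.add_apply, Real.norm_eq_abs, abs_abs]
  nlinarith [sq_abs (X ω k), sq_nonneg (|X ω k| - 1)]

end LLN

/-! ### Quantiles of conditional distributions -/

lemma cdf_map_log {ν : Measure ℝ} [IsProbabilityMeasure ν] (h0 : cdf ν 0 = 0) (s : ℝ) :
    cdf (ν.map Real.log) s = cdf ν (Real.exp s) := by
  have := Measure.isProbabilityMeasure_map (μ := ν) Real.measurable_log.aemeasurable
  rw [cdf_eq_real, cdf_eq_real, map_measureReal_apply Real.measurable_log measurableSet_Iic]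
  refine measureReal_congr ?_
  have hnull : ∀ᵐ y ∂ν, 0 < y := by
    have h : ν (Iic 0) = 0 := by
      rw [cdf_eq_real, measureReal_eq_zero_iff] at h0
      exact h0
    have e : {y : ℝ | ¬ 0 < y} = Iic 0 := by ext; simp
    rwa [ae_iff, e]
  filter_upwards [hnull] with y hy
  exact propext (Real.log_le_iff_le_exp hy)

lemma quantile_eq_exp {ν : Measure ℝ} [IsProbabilityMeasure ν] (h0 : ∀ y ≤ 0, cdf ν y = 0) {p : ℝ}
    (hp : p ∈ Ioo (0 : ℝ) 1) : quantile ν p = Real.exp (quantile (ν.map Real.log) p) := by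
  have := Measure.isProbabilityMeasure_map (μ := ν) Real.measurable_log.aemeasurable
  have hset : {t | p ≤ cdf ν t} = Real.exp '' {s | p ≤ cdf (ν.map Real.log) s} := by
    ext t
    simp only [mem_ofPred_eq, mem_image, cdf_map_log (h0 0 le_rfl)]
    constructor
    · intro ht
      have htpos : 0 < t := by
        by_contra hcon
        push Not at hcon
        rw [h0 t hcon] at ht
        linarith [hp.1]
      exact ⟨Real.log t, by rwa [Real.exp_log htpos], Real.exp_log htpos⟩
    · rintro ⟨s, hs, rfl⟩
      exact hs
  have hne : {s | p ≤ cdf (ν.map Real.log) s}.Nonempty :=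
    ((tendsto_cdf_atTop (ν.map Real.log)).eventually_const_le hp.2).exists
  have hbdd : BddBelow {s | p ≤ cdf (ν.map Real.log) s} := by
    obtain ⟨s₀, hs₀⟩ := ((tendsto_cdf_atBot (ν.map Real.log)).eventually_lt_const hp.1).exists
    refine ⟨s₀, fun s hs => ?_⟩
    by_contra hcon
    push Not at hcon
    have := monotone_cdf (ν.map Real.log) hcon.le
    exact absurd (hs.trans this) (not_le.2 hs₀)
  unfold quantile
  rw [hset, Monotone.map_csInf_of_continuousAt Real.continuous_exp.continuousAt
    Real.exp_strictMono.monotone hne hbdd]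

lemma cdf_quantile {ν : Measure ℝ} [IsProbabilityMeasure ν] (hc : Continuous (cdf ν))
    (hm : StrictMono (cdf ν)) {p : ℝ} (hp : p ∈ Ioo (0 : ℝ) 1) : cdf ν (quantile ν p) = p := by
  obtain ⟨r, hr⟩ := mem_range_of_exists_le_of_exists_ge hc
    (((tendsto_cdf_atBot ν).eventually_le_const hp.1).exists)
    (((tendsto_cdf_atTop ν).eventually_const_le hp.2).exists)
  have hset : {t | p ≤ cdf ν t} = Ici r := by
    ext t
    rw [mem_ofPred_eq, mem_Ici, ← hr, hm.le_iff_le]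
  rw [quantile, hset, csInf_Ici, hr]

/-! ### The population criterion has a unique minimiser -/

/-- Twice the check loss of order `p`. -/
def checkLoss (p u : ℝ) : ℝ := |u| + (2 * p - 1) * u

/-- The indicator `1{z ≤ s}` yields a subgradient of the check loss `c ↦ checkLoss p (z - c)`
at `s`. -/
lemma le_checkLoss_sub (p z c s : ℝ) :
    2 * (c - s) * ((Iic s).indicator 1 z - p) ≤ checkLoss p (z - c) - checkLoss p (z - s) := by
  unfold checkLoss
  by_cases h : z ≤ s
  · rw [indicator_of_mem (mem_Iic.2 h), abs_of_nonpos (sub_nonpos.2 h)]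
    simp only [Pi.one_apply]
    linarith [neg_le_abs (z - c)]
  · rw [indicator_of_notMem (by simpa using h), abs_of_pos (by linarith : 0 < z - s)]
    linarith [le_abs_self (z - c)]

lemma abs_checkLoss_sub_le {p : ℝ} (hp : p ∈ Ioo (0 : ℝ) 1) (u v : ℝ) :
    |checkLoss p u - checkLoss p v| ≤ 2 * |u - v| := by
  have h1 := abs_abs_sub_abs_le_abs_sub u v
  have h2 : |(2 * p - 1) * (u - v)| ≤ 1 * |u - v| := by
    rw [abs_mul]
    gcongr
    rw [abs_le]
    constructor <;> linarith [hp.1, hp.2]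
  have e : checkLoss p u - checkLoss p v = (|u| - |v|) + (2 * p - 1) * (u - v) := by
    unfold checkLoss; ring
  rw [e]
  exact (abs_add_le _ _).trans (by linarith)

lemma continuous_checkLoss (p : ℝ) : Continuous (checkLoss p) := by
  unfold checkLoss
  fun_prop

/-- The expected check loss is uniquely minimised at the quantile. Its increment from `q` to `c` is
estimated from below by the subgradients at `q` and at the midpoint `s` of `q` and `c`; the latter
has the sign of `c - q`. -/
lemma integral_checkLoss_sub_pos {ν : Measure ℝ} [IsProbabilityMeasure ν] (hm : StrictMono (cdf ν))
    {p : ℝ} (hp : p ∈ Ioo (0 : ℝ) 1) {q c : ℝ} (hq : cdf ν q = p) (hc : c ≠ q) :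
    0 < ∫ z, (checkLoss p (z - c) - checkLoss p (z - q)) ∂ν := by
  set s := (c + q) / 2 with hs
  have hind : ∀ r, Integrable ((Iic r).indicator (1 : ℝ → ℝ)) ν := fun r =>
    (integrable_const (1 : ℝ)).indicator measurableSet_Iic
  have hindp : ∀ r, Integrable (fun z => (Iic r).indicator (1 : ℝ → ℝ) z - p) ν := fun r =>
    (hind r).sub (integrable_const p)
  have hcdf : ∀ r, ∫ z, ((Iic r).indicator (1 : ℝ → ℝ) z - p) ∂ν = cdf ν r - p := by
    intro r
    rw [integral_sub (hind r) (integrable_const p), integral_indicator_one measurableSet_Iic,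
      cdf_eq_real]
    simp
  have hlow : ∫ z, (2 * (c - s) * ((Iic s).indicator 1 z - p) +
      2 * (s - q) * ((Iic q).indicator 1 z - p)) ∂ν ≤
      ∫ z, (checkLoss p (z - c) - checkLoss p (z - q)) ∂ν := by
    refine integral_mono (((hindp s).const_mul _).add ((hindp q).const_mul _)) ?_ fun z => ?_
    · refine Integrable.of_bound (C := 2 * |q - c|) ?_ (Eventually.of_forall fun z => ?_)
      · exact (((continuous_checkLoss p).comp (by fun_prop)).sub
          ((continuous_checkLoss p).comp (by fun_prop))).aestronglyMeasurable
      · refine (abs_checkLoss_sub_le hp _ _).trans (le_of_eq ?_)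
        congr 2
        ring
    · have h1 := le_checkLoss_sub p z c s
      have h2 := le_checkLoss_sub p z s q
      linarith
  refine lt_of_lt_of_le ?_ hlow
  rw [integral_add ((hindp s).const_mul _) ((hindp q).const_mul _), integral_const_mul,
    integral_const_mul, hcdf, hcdf, hq, sub_self, mul_zero, add_zero]
  rcases lt_or_gt_of_ne hc with h | h
  · have h1 : cdf ν s < p := hq ▸ hm (show s < q by linarith)
    exact mul_pos_of_neg_of_neg (by linarith) (by linarith)
  · have h1 : p < cdf ν s := hq ▸ hm (show q < s by linarith)
    exact mul_pos (by linarith) (by linarith)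

/-- A nontrivial affine function vanishes on a Lebesgue null set only. -/
lemma volume_linPred_eq_zero {d : ℕ} {c : Fin (d + 1) → ℝ} (hc : c ≠ 0) :
    volume {x : Fin d → ℝ | linPred c x = 0} = 0 := by
  let s : AffineSubspace ℝ (Fin d → ℝ) :=
    { carrier := {x | linPred c x = 0}
      smul_vsub_vadd_mem' := by
        intro a x y w hx hy hw
        simp only [mem_ofPred_eq, linPred] at hx hy hw ⊢
        have e : ∑ k : Fin d, c k.succ * (a • (x -ᵥ y) +ᵥ w) k =
            a * (∑ k : Fin d, c k.succ * x k) - a * (∑ k : Fin d, c k.succ * y k) +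
              ∑ k : Fin d, c k.succ * w k := by
          rw [Finset.mul_sum, Finset.mul_sum, ← Finset.sum_sub_distrib, ← Finset.sum_add_distrib]
          refine Finset.sum_congr rfl fun k _ => ?_
          simp only [vsub_eq_sub, vadd_eq_add, Pi.add_apply, Pi.smul_apply, Pi.sub_apply,
            smul_eq_mul]
          ring
        rw [e]
        linear_combination a * hx - a * hy + hw }
  have hs : s ≠ ⊤ := by
    intro h
    have hall : ∀ x : Fin d → ℝ, linPred c x = 0 := fun x => by
      have : x ∈ s := h ▸ AffineSubspace.mem_top ℝ _ x
      exact this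
    have h0 : c 0 = 0 := by simpa [linPred] using hall 0
    refine hc (funext fun i => Fin.cases h0 (fun k => ?_) i)
    have := hall (Pi.single k 1)
    simpa [linPred, h0, Pi.single_apply] using this
  exact Measure.addHaar_affineSubspace volume s hs

lemma measurable_linPred {d : ℕ} (c : Fin (d + 1) → ℝ) : Measurable (linPred c) := by
  unfold linPred
  fun_prop

section Model

variable {Ω : Type*} [MeasurableSpace Ω] {μ : Measure Ω} {d : ℕ} {X : Ω → Fin d → ℝ}

lemma CovariateDensity.ae_linPred_ne_zero (h : CovariateDensity μ X) (hX : Measurable X)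
    {c : Fin (d + 1) → ℝ} (hc : c ≠ 0) : ∀ᵐ ω ∂μ, linPred c (X ω) ≠ 0 := by
  obtain ⟨V, f, -, -, hmap, -⟩ := h
  have hac : μ.map X ≪ volume := hmap ▸ withDensity_absolutelyContinuous _ _
  have := hac (volume_linPred_eq_zero hc)
  have e : {x : Fin d → ℝ | linPred c x = 0} = linPred c ⁻¹' {0} := by ext; simp
  rw [e, Measure.map_apply hX ((measurable_linPred c) (measurableSet_singleton 0))] at this
  have e' : {ω | ¬ linPred c (X ω) ≠ 0} = X ⁻¹' (linPred c ⁻¹' {0}) := by ext; simp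
  rwa [ae_iff, e']

lemma integrable_linPred [IsFiniteMeasure μ] (hX : Measurable X)
    (hint : Integrable (fun ω => designNorm (X ω)) μ)
    (b : Fin (d + 1) → ℝ) : Integrable (fun ω => linPred b (X ω)) μ :=
  (hint.const_mul ‖b‖).mono' ((measurable_linPred b).comp hX).aestronglyMeasurable
    (Eventually.of_forall fun ω => abs_linPred_le b (X ω))

variable {Y : Ω → ℝ} {S : Set (Fin d → ℝ)} {κ : Kernel (Fin d → ℝ) ℝ} [IsMarkovKernel κ]
  {β : Fin (d + 1) → ℝ → ℝ}

lemma QRModel.continuous_cdf_log (h : QRModel μ X Y S κ β) {x : Fin d → ℝ} (hx : x ∈ S) :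
    Continuous (cdf ((κ x).map Real.log)) := by
  have e : (cdf ((κ x).map Real.log) : ℝ → ℝ) = fun s => cdf (κ x) (Real.exp s) :=
    funext fun s => cdf_map_log (h.cdf_eq_zero x hx 0 le_rfl) s
  rw [e]
  exact (h.cdf_continuousOn x hx).comp_continuous Real.continuous_exp fun s => Real.exp_pos s

lemma QRModel.strictMono_cdf_log (h : QRModel μ X Y S κ β) {x : Fin d → ℝ} (hx : x ∈ S) :
    StrictMono (cdf ((κ x).map Real.log)) := by
  intro s r hsr
  rw [cdf_map_log (h.cdf_eq_zero x hx 0 le_rfl), cdf_map_log (h.cdf_eq_zero x hx 0 le_rfl)]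
  exact h.cdf_strictMonoOn x hx (Real.exp_pos s) (Real.exp_pos r) (Real.exp_lt_exp.2 hsr)

/-- The conditional quantile function is the plug-in curve of the true coefficients. -/
lemma QRModel.quantile_eq (h : QRModel μ X Y S κ β) {x : Fin d → ℝ} (hx : x ∈ S) {p : ℝ}
    (hp : p ∈ Ioo (0 : ℝ) 1) : quantile (κ x) p = plugInQ β x p := by
  rw [quantile_eq_exp (h.cdf_eq_zero x hx) hp, h.quantile_log x hx p hp, plugInQ]

/-- The vector `β(p)` is the unique minimiser of the population criterion of order `p`. -/
lemma QRModel.integral_checkLoss_sub_pos [IsProbabilityMeasure μ] (h : QRModel μ X Y S κ β)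
    (hA1 : CovariateDensity μ X) (hint : Integrable (fun ω => designNorm (X ω)) μ)
    {p : ℝ} (hp : p ∈ Ioo (0 : ℝ) 1) {b : Fin (d + 1) → ℝ} (hb : b ≠ fun i => β i p) :
    0 < ∫ ω, (checkLoss p (Real.log (Y ω) - linPred b (X ω)) -
      checkLoss p (Real.log (Y ω) - linPred (fun i => β i p) (X ω))) ∂μ := by
  set b₀ : Fin (d + 1) → ℝ := fun i => β i p with hb₀
  set D : (Fin d → ℝ) × ℝ → ℝ := fun w => checkLoss p (Real.log w.2 - linPred b w.1) -
    checkLoss p (Real.log w.2 - linPred b₀ w.1) with hD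
  have hXY : Measurable fun ω => (X ω, Y ω) := h.measurable_X.prodMk h.measurable_Y
  have hDm : Measurable D := by
    have h1 : ∀ c : Fin (d + 1) → ℝ, Measurable fun w : (Fin d → ℝ) × ℝ =>
        checkLoss p (Real.log w.2 - linPred c w.1) := fun c =>
      (continuous_checkLoss p).measurable.comp
        ((Real.measurable_log.comp measurable_snd).sub ((measurable_linPred c).comp measurable_fst))
    exact (h1 b).sub (h1 b₀)
  have hDint : Integrable (fun ω => D (X ω, Y ω)) μ := by
    refine ((integrable_linPred h.measurable_X hint (b - b₀)).abs.const_mul 2).mono'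
      (hDm.comp hXY).aestronglyMeasurable (Eventually.of_forall fun ω => ?_)
    refine (abs_checkLoss_sub_le hp _ _).trans (le_of_eq ?_)
    rw [linPred_sub, abs_sub_comm]
    congr 2
    ring
  have hDint' : Integrable D ((μ.map X) ⊗ₘ κ) := by
    rw [← h.condLaw]
    exact (integrable_map_measure hDm.aestronglyMeasurable hXY.aemeasurable).2 hDint
  have hHint : Integrable (fun x => ∫ y, D (x, y) ∂κ x) (μ.map X) := hDint'.integral_compProd
  have e : ∫ ω, D (X ω, Y ω) ∂μ = ∫ ω, (∫ y, D (X ω, y) ∂κ (X ω)) ∂μ := by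
    rw [← integral_map (f := D) hXY.aemeasurable hDm.aestronglyMeasurable, h.condLaw,
      Measure.integral_compProd hDint', integral_map h.measurable_X.aemeasurable
        hHint.aestronglyMeasurable]
  have hpos : ∀ᵐ ω ∂μ, 0 < ∫ y, D (X ω, y) ∂κ (X ω) := by
    filter_upwards [h.mem_values, hA1.ae_linPred_ne_zero h.measurable_X (sub_ne_zero.2 hb)]
      with ω hS hne
    have := Measure.isProbabilityMeasure_map (μ := κ (X ω)) Real.measurable_log.aemeasurable
    have hq := cdf_quantile (h.continuous_cdf_log hS) (h.strictMono_cdf_log hS) hp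
    rw [h.quantile_log _ hS p hp] at hq
    rw [linPred_sub, sub_ne_zero] at hne
    have := _root_.integral_checkLoss_sub_pos (h.strictMono_cdf_log hS) hp hq hne
    rwa [integral_map Real.measurable_log.aemeasurable] at this
    exact (((continuous_checkLoss p).comp (by fun_prop)).sub
      ((continuous_checkLoss p).comp (by fun_prop))).aestronglyMeasurable
  change 0 < ∫ ω, D (X ω, Y ω) ∂μ
  rw [e, integral_pos_iff_support_of_nonneg_ae (hpos.mono fun ω hω => hω.le)
    (hHint.comp_measurable h.measurable_X)]
  have hsupp : (Function.support fun ω => ∫ y, D (X ω, y) ∂κ (X ω)) =ᵐ[μ] univ := by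
    filter_upwards [hpos] with ω hω
    exact propext ⟨fun _ => trivial, fun _ => hω.ne'⟩
  rw [measure_congr hsupp, measure_univ]
  exact one_pos

end Model

/-! ### Consistency of the estimates, uniformly in the order -/

section Consistency

variable {Ω : Type*} [MeasurableSpace Ω] {μ : Measure Ω} [IsProbabilityMeasure μ] {d : ℕ}
  {X : Ω → Fin d → ℝ} {Z : Ω → ℝ} {Xs : ℕ → Ω → Fin d → ℝ} {Zs : ℕ → Ω → ℝ}

lemma measurable_designNorm : Measurable (designNorm : (Fin d → ℝ) → ℝ) := by
  unfold designNorm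
  fun_prop

lemma abs_linPred_sub_le (b c : Fin (d + 1) → ℝ) (x : Fin d → ℝ) :
    |linPred b x - linPred c x| ≤ dist b c * designNorm x := by
  rw [← linPred_sub, dist_eq_norm]
  exact abs_linPred_le _ _

lemma abs_excess_sub_le (b c : Fin (d + 1) → ℝ) (x : Fin d → ℝ) (z : ℝ) :
    |(|z - linPred b x| - |z|) - (|z - linPred c x| - |z|)| ≤ dist b c * designNorm x := by
  rw [sub_sub_sub_cancel_right]
  refine (abs_abs_sub_abs_le_abs_sub _ _).trans ?_
  rw [sub_sub_sub_cancel_left, abs_sub_comm]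
  exact abs_linPred_sub_le b c x

lemma integrable_excess (hX : Measurable X) (hZ : Measurable Z)
    (hint : Integrable (fun ω => designNorm (X ω)) μ) (b : Fin (d + 1) → ℝ) :
    Integrable (fun ω => |Z ω - linPred b (X ω)| - |Z ω|) μ := by
  refine (integrable_linPred hX hint b).abs.mono'
    ((hZ.sub ((measurable_linPred b).comp hX)).abs.sub hZ.abs).aestronglyMeasurable
    (Eventually.of_forall fun ω => ?_)
  refine (abs_abs_sub_abs_le_abs_sub _ _).trans (le_of_eq ?_)
  rw [sub_sub_cancel_left, abs_neg]

/-- The population counterpart of `excessLoss`. -/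
def populationLoss (μ : Measure Ω) (X : Ω → Fin d → ℝ) (Z : Ω → ℝ) (p : ℝ)
    (b : Fin (d + 1) → ℝ) : ℝ :=
  (∫ ω, (|Z ω - linPred b (X ω)| - |Z ω|) ∂μ) - (2 * p - 1) * ∫ ω, linPred b (X ω) ∂μ

lemma continuous_populationLoss (hX : Measurable X) (hZ : Measurable Z)
    (hint : Integrable (fun ω => designNorm (X ω)) μ) :
    Continuous (Function.uncurry (populationLoss μ X Z)) := by
  have h1 := continuous_integral_of_lipschitz (integrable_excess hX hZ hint) hint
    fun b c ω => abs_excess_sub_le b c (X ω) (Z ω)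
  have h2 := continuous_integral_of_lipschitz (integrable_linPred hX hint) hint
    fun b c ω => abs_linPred_sub_le b c (X ω)
  exact (h1.comp continuous_snd).sub
    (((continuous_const.mul continuous_fst).sub continuous_const).mul (h2.comp continuous_snd))

lemma populationLoss_sub (hX : Measurable X) (hZ : Measurable Z)
    (hint : Integrable (fun ω => designNorm (X ω)) μ) (p : ℝ) (b c : Fin (d + 1) → ℝ) :
    populationLoss μ X Z p b - populationLoss μ X Z p c =
      ∫ ω, (checkLoss p (Z ω - linPred b (X ω)) - checkLoss p (Z ω - linPred c (X ω))) ∂μ := by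
  have hb := integrable_excess hX hZ hint b
  have hc := integrable_excess hX hZ hint c
  have hb' := (integrable_linPred hX hint b).const_mul (2 * p - 1)
  have hc' := (integrable_linPred hX hint c).const_mul (2 * p - 1)
  have hb'' : Integrable (fun ω => |Z ω - linPred b (X ω)| - |Z ω| -
    (2 * p - 1) * linPred b (X ω)) μ := hb.sub hb'
  have hc'' : Integrable (fun ω => |Z ω - linPred c (X ω)| - |Z ω| -
    (2 * p - 1) * linPred c (X ω)) μ := hc.sub hc'
  unfold populationLoss
  rw [← integral_const_mul, ← integral_const_mul, ← integral_sub hb hb', ← integral_sub hc hc',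
    ← integral_sub hb'' hc'']
  refine integral_congr_ae (Eventually.of_forall fun ω => ?_)
  simp only [checkLoss]
  ring

/-- With high probability the sample criterion is uniformly close to the population criterion. -/
lemma IsIIDCopies.highProb_excessLoss_close (h : IsIIDCopies μ X Z Xs Zs)
    (hint : Integrable (fun ω => designNorm (X ω)) μ) (R : ℝ) {ε : ℝ} (hε : 0 < ε) :
    HighProb μ atTop fun (n : ℕ) ω => ∀ p ∈ Icc (0 : ℝ) 1, ∀ b : Fin (d + 1) → ℝ, ‖b‖ ≤ R →
      |excessLoss n (fun i => Xs i ω) (fun i => Zs i ω) p b - populationLoss μ X Z p b| ≤ ε := by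
  have hg : Measurable fun w : (Fin d → ℝ) × ℝ => designNorm w.1 :=
    measurable_designNorm.comp measurable_fst
  have hlin : ∀ b : Fin (d + 1) → ℝ, Measurable fun w : (Fin d → ℝ) × ℝ => linPred b w.1 :=
    fun b => (measurable_linPred b).comp measurable_fst
  have h1 := h.highProb_mean_uniform (isCompact_closedBall (0 : Fin (d + 1) → ℝ) R)
    (φ := fun b w => |w.2 - linPred b w.1| - |w.2|)
    (fun b => (measurable_snd.sub (hlin b)).abs.sub measurable_snd.abs)
    (integrable_excess h.measurable_X h.measurable_Z hint) hg hint
    (fun w => designNorm_nonneg w.1) (fun b c w => abs_excess_sub_le b c w.1 w.2) (half_pos hε)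
  have h2 := h.highProb_mean_uniform (isCompact_closedBall (0 : Fin (d + 1) → ℝ) R)
    (φ := fun b w => linPred b w.1) hlin (integrable_linPred h.measurable_X hint) hg hint
    (fun w => designNorm_nonneg w.1) (fun b c w => abs_linPred_sub_le b c w.1) (half_pos hε)
  refine (h1.and h2).mono fun n ω hω p hp b hb => ?_
  have hb' : b ∈ Metric.closedBall (0 : Fin (d + 1) → ℝ) R := by simpa using hb
  have k1 := hω.1 b hb'
  have k2 := hω.2 b hb'
  simp only at k1 k2
  have hp' : |2 * p - 1| ≤ 1 := by rw [abs_le]; constructor <;> linarith [hp.1, hp.2]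
  unfold excessLoss populationLoss
  set G := sampleMean n fun i => |Zs i ω - linPred b (Xs i ω)| - |Zs i ω|
  set W := sampleMean n fun i => linPred b (Xs i ω)
  set G' := ∫ ω, (|Z ω - linPred b (X ω)| - |Z ω|) ∂μ
  set W' := ∫ ω, linPred b (X ω) ∂μ
  have e : G - (2 * p - 1) * W - (G' - (2 * p - 1) * W') = (G - G') - (2 * p - 1) * (W - W') := by
    ring
  rw [e]
  refine (abs_sub _ _).trans ?_
  rw [abs_mul]
  have : |2 * p - 1| * |W - W'| ≤ 1 * |W - W'| := by gcongr
  linarith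

/-- With high probability, all fits of orders in `[η, 1 - η]` are simultaneously close to the true
coefficients. -/
lemma highProb_aqr_close {Y : Ω → ℝ} {S : Set (Fin d → ℝ)} {κ : Kernel (Fin d → ℝ) ℝ}
    [IsMarkovKernel κ] {β : Fin (d + 1) → ℝ → ℝ} (hmodel : QRModel μ X Y S κ β)
    (h : IsIIDCopies μ X (fun ω => Real.log (Y ω)) Xs Zs)
    (hA1 : CovariateDensity μ X) (hint : Integrable (fun ω => designNorm (X ω)) μ)
    {τ : ℕ → ℝ} (hτpos : ∀ n, 0 < τ n) (hτ : Tendsto τ atTop (𝓝 0)) {η : ℝ}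
    (hη : η ∈ Ioo (0 : ℝ) (1 / 2)) {δ : ℝ} (hδ : 0 < δ) :
    HighProb μ atTop fun (n : ℕ) ω => ∀ p ∈ Icc η (1 - η), ∀ c,
      IsAQR (τ n) p n (fun i => Xs i ω) (fun i => Zs i ω) c → ∀ i, |c i - β i p| ≤ δ := by
  have hsub : Icc η (1 - η) ⊆ Ioo (0 : ℝ) 1 := fun p hp =>
    ⟨hη.1.trans_le hp.1, by linarith [hp.2, hη.1]⟩
  obtain ⟨ε, hε, R, hR⟩ := exists_approx_argmin_close (isCompact_Icc (a := η) (b := 1 - η))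
    (β := fun p i => β i p) (continuousOn_pi.2 fun i => hmodel.beta_continuousOn i η hη)
    (continuous_populationLoss h.measurable_X h.measurable_Z hint)
    (fun p hp b hb => by
      rw [← sub_pos, populationLoss_sub h.measurable_X h.measurable_Z hint]
      exact hmodel.integral_checkLoss_sub_pos hA1 hint (hsub hp) hb) hδ
  refine (h.highProb_excessLoss_close hint R hε).mono_eventually ?_
  filter_upwards [hτ.eventually_le_const (half_pos hε), eventually_gt_atTop 0]
    with n hτn hn ω hω p hp c hc i
  have := hR (excessLoss n (fun i => Xs i ω) (fun i => Zs i ω))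
    (fun p _ => convexOn_excessLoss n _ _ p)
    (fun p hp b hb => hω p (Ioo_subset_Icc_self (hsub hp)) b hb) p hp c
    (fun b => (hc.excessLoss_le (hτpos n) hn b).trans (by linarith))
  exact (norm_le_pi_norm (c - fun i => β i p) i).trans this.le

/-! ### Fits of extreme orders -/

/-- With high probability the mean absolute linear predictor is bounded below by a multiple of the
norm of the coefficient vector, uniformly over all coefficient vectors. -/
lemma IsIIDCopies.exists_highProb_norm_le (h : IsIIDCopies μ X Z Xs Zs)
    (hint : Integrable (fun ω => designNorm (X ω)) μ)
    (hne : ∀ c : Fin (d + 1) → ℝ, c ≠ 0 → ∀ᵐ ω ∂μ, linPred c (X ω) ≠ 0) :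
    ∃ c₀ > 0, HighProb μ atTop fun (n : ℕ) ω => ∀ b : Fin (d + 1) → ℝ,
      c₀ * ‖b‖ ≤ sampleMean n (fun i => |linPred b (Xs i ω)|) := by
  have hlip : ∀ (b c : Fin (d + 1) → ℝ) (x : Fin d → ℝ),
      |(|linPred b x|) - (|linPred c x|)| ≤ dist b c * designNorm x := fun b c x =>
    (abs_abs_sub_abs_le_abs_sub _ _).trans (abs_linPred_sub_le b c x)
  have habs := fun b => (integrable_linPred h.measurable_X hint b).abs
  have hcont := continuous_integral_of_lipschitz habs hint fun b c ω => hlip b c (X ω)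
  have hsph := isCompact_sphere (0 : Fin (d + 1) → ℝ) 1
  obtain ⟨c₁, hc₁, hc₁le⟩ := hsph.exists_forall_le' hcont.continuousOn (a := 0) (by
    intro b hb
    have hb0 : b ≠ 0 := by
      rintro rfl
      simp at hb
    rw [integral_pos_iff_support_of_nonneg_ae (Eventually.of_forall fun ω => abs_nonneg _)
      (habs b)]
    have hsupp : (Function.support fun ω => |linPred b (X ω)|) =ᵐ[μ] univ := by
      filter_upwards [hne b hb0] with ω hω
      exact propext ⟨fun _ => trivial, fun _ => (abs_pos.2 hω).ne'⟩
    rw [measure_congr hsupp, measure_univ]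
    exact one_pos)
  refine ⟨c₁ / 2, half_pos hc₁, ?_⟩
  refine (h.highProb_mean_uniform hsph (φ := fun b w => |linPred b w.1|)
    (fun b => ((measurable_linPred b).comp measurable_fst).abs) habs
    (measurable_designNorm.comp measurable_fst) hint (fun w => designNorm_nonneg w.1)
    (fun b c w => hlip b c w.1) (half_pos hc₁)).mono fun n ω hω b => ?_
  rcases eq_or_ne b 0 with rfl | hb
  · rw [norm_zero, mul_zero]
    exact (abs_nonneg _).trans (abs_sampleMean_le n _)
  have hb' : 0 < ‖b‖ := norm_pos_iff.2 hb
  -- reduction to the unit sphere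
  set u : Fin (d + 1) → ℝ := ‖b‖⁻¹ • b with hu
  have hus : u ∈ Metric.sphere (0 : Fin (d + 1) → ℝ) 1 := by
    rw [mem_sphere_zero_iff_norm, hu, norm_smul, norm_inv, norm_norm, inv_mul_cancel₀ hb'.ne']
  have h1 := (abs_le.1 (hω u hus)).1
  have h2 := hc₁le u hus
  simp only at h1 h2
  have e : sampleMean n (fun i => |linPred b (Xs i ω)|) =
      ‖b‖ * sampleMean n (fun i => |linPred u (Xs i ω)|) := by
    rw [← sampleMean_const_mul]
    congr 1
    ext i
    rw [hu, linPred_smul, abs_mul, abs_of_pos (inv_pos.2 hb'), mul_inv_cancel_left₀ hb'.ne']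
  rw [e, mul_comm]
  gcongr
  linarith

/-- The criterion of the constant predictor `-K` at order `0` vanishes as `K → ∞`. -/
lemma tendsto_integral_abs_add_sub (hZ : Integrable Z μ) :
    Tendsto (fun K : ℕ => ∫ ω, (|Z ω + K| - (Z ω + K)) ∂μ) atTop (𝓝 0) := by
  have h := tendsto_integral_of_dominated_convergence (μ := μ)
    (F := fun (K : ℕ) ω => |Z ω + K| - (Z ω + K)) (f := fun _ => 0) (fun ω => 2 * |Z ω|)
    (fun K => ((hZ.add (integrable_const (K : ℝ))).abs.sub
      (hZ.add (integrable_const (K : ℝ)))).aestronglyMeasurable) (hZ.abs.const_mul 2)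
    (fun K => Eventually.of_forall fun ω => by
      have hK : (0 : ℝ) ≤ K := Nat.cast_nonneg K
      rw [Real.norm_eq_abs, abs_le]
      rcases abs_cases (Z ω + K) with ⟨h1, _⟩ | ⟨h1, _⟩ <;>
        rcases abs_cases (Z ω) with ⟨h2, _⟩ | ⟨h2, _⟩ <;> rw [h1, h2] <;>
        constructor <;> linarith)
    (Eventually.of_forall fun ω => by
      refine tendsto_const_nhds.congr' ?_
      filter_upwards [eventually_ge_atTop ⌈-Z ω⌉₊] with K hK
      have : -Z ω ≤ K := Nat.ceil_le.1 hK
      rw [abs_of_nonneg (by linarith), sub_self])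
  simpa using h

/-- With high probability the fits of the lowest orders have a small accumulated norm, for all grid
sizes simultaneously. -/
lemma IsIIDCopies.exists_highProb_sum_norm_le (h : IsIIDCopies μ X Z Xs Zs)
    (hint : Integrable (fun ω => designNorm (X ω)) μ) (hZ : Integrable Z μ)
    (hne : ∀ c : Fin (d + 1) → ℝ, c ≠ 0 → ∀ᵐ ω ∂μ, linPred c (X ω) ≠ 0)
    {τ : ℕ → ℝ} (hτpos : ∀ n, 0 < τ n) (hτ : Tendsto τ atTop (𝓝 0)) {ε : ℝ} (hε : 0 < ε) :
    ∃ η₀ > 0, HighProb μ atTop fun (n : ℕ) ω => ∀ (m : ℕ) (c : ℕ → Fin (d + 1) → ℝ),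
      (∀ j ∈ Ico 1 m, IsAQR (τ n) ((j : ℝ) / m) n (fun i => Xs i ω) (fun i => Zs i ω) (c j)) →
      ∀ J : ℕ, J < m → (J : ℝ) ≤ η₀ * m → ∑ j ∈ Finset.Icc 1 J, ‖c j‖ ≤ ε * m := by
  obtain ⟨c₀, hc₀, hnorm⟩ := h.exists_highProb_norm_le hint hne
  obtain ⟨K, hK⟩ := ((tendsto_integral_abs_add_sub hZ).eventually_lt_const
    (show 0 < c₀ * ε / 8 by positivity)).exists
  set T := (∫ ω, |Z ω| ∂μ) + 1 with hT
  have hT0 : 0 ≤ T := by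
    have : 0 ≤ ∫ ω, |Z ω| ∂μ := integral_nonneg fun ω => abs_nonneg _
    linarith
  set η₀ := min (1 / 4) (c₀ * ε / (4 * (6 * T + 4 + K))) with hη₀
  have hK0 : (0 : ℝ) ≤ K := Nat.cast_nonneg K
  have hη₀pos : 0 < η₀ := by positivity
  have hη₀le : η₀ * (6 * T + 4 + K) ≤ c₀ * ε / 4 := by
    have h1 : η₀ ≤ c₀ * ε / 4 / (6 * T + 4 + K) := by
      rw [div_div]; exact min_le_right _ _
    rwa [le_div_iff₀ (by positivity)] at h1
  have hZK : Integrable (fun ω => |Z ω + K| - (Z ω + K)) μ :=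
    (hZ.add (integrable_const (K : ℝ))).abs.sub (hZ.add (integrable_const (K : ℝ)))
  have habs := h.highProb_mean (φ := fun w => |w.2|) measurable_snd.abs hZ.abs one_pos
  have htail := h.highProb_mean (φ := fun w => |w.2 + K| - (w.2 + K))
    ((measurable_snd.add_const _).abs.sub (measurable_snd.add_const _)) hZK
    (show 0 < c₀ * ε / 8 by positivity)
  refine ⟨η₀, hη₀pos, (hnorm.and (habs.and htail)).mono_eventually ?_⟩
  filter_upwards [hτ.eventually_le_const (show 0 < min 1 (c₀ * ε / 4) by positivity),
    eventually_gt_atTop 0] with n hτn hn ω hω m c hc J hJm hJη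
  obtain ⟨h1, h2, h3⟩ := hω
  have h2' := (abs_lt.1 h2).2
  have h3' := (abs_lt.1 h3).2
  have hτ1 : τ n ≤ 1 := hτn.trans (min_le_left _ _)
  have hτ2 : τ n ≤ c₀ * ε / 4 := hτn.trans (min_le_right _ _)
  rcases Nat.eq_zero_or_pos J with rfl | hJ1
  · simp only [Finset.Icc_eq_empty_of_lt zero_lt_one, Finset.sum_empty]
    positivity
  have hm : (0 : ℝ) < m := by
    have : 0 < m := by omega
    exact_mod_cast this
  have key := sum_norm_le_of_isAQR (hτpos n) hn hc h1 (T := T) (by linarith) hK0 hJ1 hJm hJη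
    (min_le_left _ _)
  have h4 : η₀ * (6 * T + 4 * τ n + K) ≤ η₀ * (6 * T + 4 + K) := by
    gcongr
    linarith
  have h5 : c₀ / m * ∑ j ∈ Finset.Icc 1 J, ‖c j‖ ≤ c₀ / m * (ε * m) := by
    have e : c₀ / m * (ε * m) = c₀ * ε := by field_simp
    rw [e]
    have : 0 < c₀ * ε := by positivity
    linarith
  exact le_of_mul_le_mul_left h5 (by positivity)

end Consistency

/-! ### From coefficient curves to quantile functions and inequality curves -/

lemma abs_exp_sub_exp_le {a b C δ : ℝ} (hb : b ≤ C) (hab : |a - b| ≤ δ) (hδ : δ ≤ 1) :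
    |Real.exp a - Real.exp b| ≤ 2 * Real.exp C * δ := by
  have h1 := Real.abs_exp_sub_one_le (hab.trans hδ)
  have e : Real.exp a - Real.exp b = Real.exp b * (Real.exp (a - b) - 1) := by
    rw [mul_sub, ← Real.exp_add]
    congr 2 <;> ring
  rw [e, abs_mul, Real.abs_exp]
  have h2 : Real.exp b ≤ Real.exp C := Real.exp_le_exp.2 hb
  calc Real.exp b * |Real.exp (a - b) - 1| ≤ Real.exp C * (2 * |a - b|) := by gcongr
    _ ≤ Real.exp C * (2 * δ) := by gcongr
    _ = _ := by ring

lemma measurable_qZ {Q : ℝ → ℝ} (hQ : Measurable Q) : Measurable (qZ Q) := by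
  unfold qZ
  refine Measurable.ite ?_ measurable_const ?_
  · exact (measurableSet_singleton (0 : ℝ)).union (measurableSet_singleton (1 : ℝ))
  · exact measurable_const.sub ((hQ.comp (by fun_prop)).div (hQ.comp (by fun_prop)))

section PlugIn

variable {Ω : Type*} [MeasurableSpace Ω] {μ : Measure Ω} {d : ℕ} {X : Ω → Fin d → ℝ} {Y : Ω → ℝ}
  {S : Set (Fin d → ℝ)} {κ : Kernel (Fin d → ℝ) ℝ} {β : Fin (d + 1) → ℝ → ℝ}

lemma QRModel.continuousOn_linPred (h : QRModel μ X Y S κ β) {η : ℝ}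
    (hη : η ∈ Ioo (0 : ℝ) (1 / 2)) (x : Fin d → ℝ) :
    ContinuousOn (fun p => linPred (fun i => β i p) x) (Icc η (1 - η)) := by
  unfold linPred
  exact (h.beta_continuousOn 0 η hη).add (continuousOn_finsetSum _ fun k _ =>
    (h.beta_continuousOn k.succ η hη).mul continuousOn_const)

lemma half_mem_Icc {η p : ℝ} (hη : 0 < η) (hp : p ∈ Icc η (1 - η)) :
    p / 2 ∈ Icc (η / 2) (1 - η / 2) ∧ 1 / 2 + p / 2 ∈ Icc (η / 2) (1 - η / 2) := by
  obtain ⟨h1, h2⟩ := hp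
  refine ⟨⟨?_, ?_⟩, ?_, ?_⟩ <;> linarith

/-- For plug-in quantile functions the ratio in `qZ` is the exponential of a difference of linear
predictors. -/
lemma qZ_plugInQ (B : Fin (d + 1) → ℝ → ℝ) (x : Fin d → ℝ) {p : ℝ} (hp : p ∈ Ioo (0 : ℝ) 1) :
    qZ (plugInQ B x) p = 1 - Real.exp (linPred (fun i => B i (p / 2)) x -
      linPred (fun i => B i (1 / 2 + p / 2)) x) := by
  have : ¬ (p = 0 ∨ p = 1) := by
    rintro (rfl | rfl)
    · exact hp.1.false
    · exact hp.2.false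
  rw [qZ, if_neg this, plugInQ, plugInQ, Real.exp_sub]

variable [IsMarkovKernel κ]

/-- Uniform consistency in probability of coefficient curves implies that of the fitted quantile
functions, of the inequality curves and of their integrals. -/
lemma QRModel.tendsto_of_coef (h : QRModel μ X Y S κ β) {ι : Type*} {l : Filter ι}
    {B : ι → Ω → Fin (d + 1) → ℝ → ℝ} (hBm : ∀ a ω i, Measurable (B a ω i))
    (hB : ∀ η ∈ Ioo (0 : ℝ) (1 / 2), ∀ i,
      TendstoInProbUniformlyOn μ (fun a ω => B a ω i) (β i) l (Icc η (1 - η)))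
    {η : ℝ} (hη : η ∈ Ioo (0 : ℝ) (1 / 2)) {x : Fin d → ℝ} (hx : x ∈ S) :
    TendstoInProbUniformlyOn μ (fun a ω => plugInQ (B a ω) x) (quantile (κ x)) l
        (Icc η (1 - η)) ∧
      TendstoInProbUniformlyOn μ (fun a ω => qZ (plugInQ (B a ω) x)) (qZ (quantile (κ x))) l
        (Icc η (1 - η)) ∧
      TendstoInMeasure μ (fun a ω => ∫ p in η..(1 - η), qZ (plugInQ (B a ω) x) p) l
        (fun _ => ∫ p in η..(1 - η), qZ (quantile (κ x)) p) := by
  obtain ⟨hη0, hη1⟩ := hη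
  have hη2 : η / 2 ∈ Ioo (0 : ℝ) (1 / 2) := ⟨by linarith, by linarith⟩
  have hsub : Icc η (1 - η) ⊆ Icc (η / 2) (1 - η / 2) := Icc_subset_Icc (by linarith) (by linarith)
  have hsub' : Icc (η / 2) (1 - η / 2) ⊆ Ioo (0 : ℝ) 1 := fun p hp =>
    ⟨by linarith [hp.1], by linarith [hp.2]⟩
  have hηI : Icc η (1 - η) ⊆ Ioo (0 : ℝ) 1 := hsub.trans hsub'
  have hlcont := h.continuousOn_linPred hη2 x
  obtain ⟨C, hC⟩ := (isCompact_Icc.image_of_continuousOn hlcont).isBounded.exists_norm_le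
  have hCle : ∀ p ∈ Icc (η / 2) (1 - η / 2), |linPred (fun i => β i p) x| ≤ C := fun p hp =>
    hC _ ⟨p, hp, rfl⟩
  have hC0 : 0 ≤ C := (abs_nonneg _).trans (hCle (1 / 2) ⟨by linarith, by linarith⟩)
  -- the linear predictors are uniformly close with high probability
  have hlin : ∀ δ, 0 < δ → HighProb μ l fun a ω => ∀ p ∈ Icc (η / 2) (1 - η / 2),
      |linPred (fun i => B a ω i p) x - linPred (fun i => β i p) x| ≤ δ := by
    intro δ hδ
    have hN : 0 < designNorm x := by unfold designNorm; positivity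
    refine (HighProb.finset_forall Finset.univ fun i _ =>
      (tendstoInProbUniformlyOn_iff.1 (hB _ hη2 i)) (δ / designNorm x) (by positivity)).mono
      fun a ω hω p hp => ?_
    refine (abs_linPred_sub_le _ _ x).trans ?_
    rw [← le_div_iff₀ hN, dist_pi_le_iff (by positivity)]
    exact fun i => hω i (Finset.mem_univ i) p hp
  have hq : ∀ p ∈ Icc (η / 2) (1 - η / 2), quantile (κ x) p = plugInQ β x p := fun p hp =>
    h.quantile_eq hx (hsub' hp)
  have hqZ : ∀ p ∈ Icc η (1 - η), qZ (quantile (κ x)) p = qZ (plugInQ β x) p := by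
    intro p hp
    obtain ⟨h1, h2⟩ := half_mem_Icc hη0 hp
    simp only [qZ, hq _ h1, hq _ h2]
  have hZ : ∀ ε, 0 < ε → HighProb μ l fun a ω => ∀ p ∈ Icc η (1 - η),
      |qZ (plugInQ (B a ω) x) p - qZ (quantile (κ x)) p| ≤ ε := by
    intro ε hε
    set δ := min (1 / 2) (ε / (4 * Real.exp (2 * C))) with hδ
    refine (hlin δ (by positivity)).mono fun a ω hω p hp => ?_
    obtain ⟨h1, h2⟩ := half_mem_Icc hη0 hp
    rw [hqZ p hp, qZ_plugInQ _ _ (hηI hp), qZ_plugInQ _ _ (hηI hp), sub_sub_sub_cancel_left,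
      abs_sub_comm]
    have k1 := abs_le.1 (hω _ h1)
    have k2 := abs_le.1 (hω _ h2)
    have b1 := abs_le.1 (hCle _ h1)
    have b2 := abs_le.1 (hCle _ h2)
    have hδ1 : δ ≤ 1 / 2 := min_le_left _ _
    have hδ2 : δ ≤ ε / (4 * Real.exp (2 * C)) := min_le_right _ _
    rw [le_div_iff₀ (by positivity)] at hδ2
    refine (abs_exp_sub_exp_le (C := 2 * C) (δ := 2 * δ) (by linarith) ?_ (by linarith)).trans
      (by linarith)
    rw [abs_le]
    constructor <;> linarith
  refine ⟨?_, tendstoInProbUniformlyOn_iff.2 hZ, ?_⟩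
  · rw [tendstoInProbUniformlyOn_iff]
    intro ε hε
    set δ := min 1 (ε / (2 * Real.exp C)) with hδ
    refine (hlin δ (by positivity)).mono fun a ω hω p hp => ?_
    rw [hq p (hsub hp)]
    have hδ2 : δ ≤ ε / (2 * Real.exp C) := min_le_right _ _
    rw [le_div_iff₀ (by positivity)] at hδ2
    exact (abs_exp_sub_exp_le (le_of_abs_le (hCle p (hsub hp))) (hω p (hsub hp))
      (min_le_left _ _)).trans (by linarith)
  · refine tendstoInMeasure_of_highProb fun ε hε => (hZ ε hε).mono fun a ω hω => ?_
    have hle : η ≤ 1 - η := by linarith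
    have hGi : IntervalIntegrable (qZ (quantile (κ x))) volume η (1 - η) := by
      refine ContinuousOn.intervalIntegrable_of_Icc hle ?_
      have hc : ContinuousOn (fun p => 1 - Real.exp (linPred (fun i => β i (p / 2)) x -
          linPred (fun i => β i (1 / 2 + p / 2)) x)) (Icc η (1 - η)) :=
        continuousOn_const.sub (Real.continuous_exp.comp_continuousOn
          ((hlcont.comp (f := fun p : ℝ => p / 2) (by fun_prop)
            fun p hp => (half_mem_Icc hη0 hp).1).sub
          (hlcont.comp (f := fun p : ℝ => 1 / 2 + p / 2) (by fun_prop)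
            fun p hp => (half_mem_Icc hη0 hp).2)))
      exact hc.congr fun p hp => by rw [hqZ p hp, qZ_plugInQ _ _ (hηI hp)]
    have hQm : Measurable (plugInQ (B a ω) x) := by
      unfold plugInQ linPred
      exact Real.measurable_exp.comp ((hBm a ω 0).add
        (Finset.measurable_sum _ fun k _ => (hBm a ω k.succ).mul_const _))
    have hDi : IntervalIntegrable
        (fun p => qZ (plugInQ (B a ω) x) p - qZ (quantile (κ x)) p) volume η (1 - η) := by
      rw [intervalIntegrable_iff_integrableOn_Icc_of_le hle] at hGi ⊢
      refine IntegrableOn.of_bound (by simp)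
        ((measurable_qZ hQm).aestronglyMeasurable.sub hGi.aestronglyMeasurable) ε ?_
      filter_upwards [ae_restrict_mem measurableSet_Icc] with p hp
      exact hω p hp
    have hFi : IntervalIntegrable (qZ (plugInQ (B a ω) x)) volume η (1 - η) := by
      have := hDi.add hGi
      exact this.congr fun p _ => sub_add_cancel _ _
    rw [← intervalIntegral.integral_sub hFi hGi]
    have hb := intervalIntegral.norm_integral_le_of_norm_le_const (a := η) (b := 1 - η) (C := ε)
      (f := fun p => qZ (plugInQ (B a ω) x) p - qZ (quantile (κ x)) p) fun p hp => by
        rw [uIoc_of_le hle] at hp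
        exact hω p ⟨hp.1.le, hp.2⟩
    refine hb.trans ?_
    rw [abs_of_nonneg (by linarith)]
    nlinarith

end PlugIn

/-! ### Estimates on the grid and interpolated curves -/

/-- Uniform consistency on the grid carries over to the interpolated coefficient curves. -/
lemma tendstoInProbUniformlyOn_coefCurve {Ω : Type*} [MeasurableSpace Ω] {μ : Measure Ω} {d : ℕ}
    {β : Fin (d + 1) → ℝ → ℝ}
    (hβ : ∀ i, ∀ η ∈ Ioo (0 : ℝ) (1 / 2), ContinuousOn (β i) (Icc η (1 - η)))
    {c : ℕ → ℕ → Ω → ℕ → Fin (d + 1) → ℝ}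
    (hc : ∀ η ∈ Ioo (0 : ℝ) (1 / 2), ∀ i, ∀ ε, 0 < ε → HighProb μ (atTop ×ˢ atTop)
      fun (a : ℕ × ℕ) ω => ∀ j ∈ Ico 1 a.1, (j : ℝ) / a.1 ∈ Icc η (1 - η) →
        |c a.1 a.2 ω j i - β i ((j : ℝ) / a.1)| ≤ ε) :
    ∀ η ∈ Ioo (0 : ℝ) (1 / 2), ∀ i, TendstoInProbUniformlyOn μ
      (fun (a : ℕ × ℕ) ω => coefCurve a.1 (c a.1 a.2 ω) i) (β i) (atTop ×ˢ atTop)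
      (Icc η (1 - η)) := by
  intro η hη i
  rw [tendstoInProbUniformlyOn_iff]
  intro ε hε
  have hη2 : η / 2 ∈ Ioo (0 : ℝ) (1 / 2) := ⟨by linarith [hη.1], by linarith [hη.1, hη.2]⟩
  obtain ⟨m₀, hm₀⟩ := exists_linInterp_close hη (hβ i _ hη2) hε
  refine (hc _ hη2 i _ (half_pos hε)).mono_eventually ?_
  filter_upwards [(tendsto_fst (f := atTop) (g := (atTop : Filter ℕ))).eventually
    (eventually_ge_atTop m₀)] with a ha ω hω
  exact hm₀ a.1 ha _ hω

section Estimates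

variable {Ω : Type*} [MeasurableSpace Ω] {μ : Measure Ω} [IsProbabilityMeasure μ] {d : ℕ}
  {X : Ω → Fin d → ℝ} {Y : Ω → ℝ} {S : Set (Fin d → ℝ)} {κ : Kernel (Fin d → ℝ) ℝ}
  [IsMarkovKernel κ] {β : Fin (d + 1) → ℝ → ℝ} {Xs : ℕ → Ω → Fin d → ℝ} {Zs : ℕ → Ω → ℝ}
  {τ : ℕ → ℝ} {b t : ℕ → ℕ → Ω → ℕ → Fin (d + 1) → ℝ}

/-- With high probability the estimates at all inner grid points are close to the true
coefficients; the grid size plays no role. -/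
lemma highProb_aqr_grid_close (hmodel : QRModel μ X Y S κ β)
    (h : IsIIDCopies μ X (fun ω => Real.log (Y ω)) Xs Zs) (hA1 : CovariateDensity μ X)
    (hint : Integrable (fun ω => designNorm (X ω)) μ) (hτpos : ∀ n, 0 < τ n)
    (hτ : Tendsto τ atTop (𝓝 0))
    (hb : ∀ (m n : ℕ) ω, ∀ j ∈ Ico 1 m,
      IsAQR (τ n) ((j : ℝ) / m) n (fun i => Xs i ω) (fun i => Zs i ω) (b m n ω j))
    {η : ℝ} (hη : η ∈ Ioo (0 : ℝ) (1 / 2)) (i : Fin (d + 1)) {ε : ℝ} (hε : 0 < ε) :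
    HighProb μ (atTop ×ˢ atTop) fun (a : ℕ × ℕ) ω =>
      ∀ j ∈ Ico 1 a.1, (j : ℝ) / a.1 ∈ Icc η (1 - η) →
        |b a.1 a.2 ω j i - β i ((j : ℝ) / a.1)| ≤ ε :=
  ((highProb_aqr_close hmodel h hA1 hint hτpos hτ hη hε).comp
    (tendsto_snd (f := (atTop : Filter ℕ)))).mono
    fun a ω hω j hj hjη => hω _ hjη _ (hb a.1 a.2 ω j hj) i

/-- With high probability the isotonic estimates at all inner grid points are close to the true
coefficients. Integrability of `log Y` enters through the extreme orders only. -/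
lemma highProb_isotonic_grid_close (hmodel : QRModel μ X Y S κ β)
    (h : IsIIDCopies μ X (fun ω => Real.log (Y ω)) Xs Zs) (hA1 : CovariateDensity μ X)
    (hint : Integrable (fun ω => designNorm (X ω)) μ)
    (hY : Integrable (fun ω => Real.log (Y ω)) μ) (hτpos : ∀ n, 0 < τ n)
    (hτ : Tendsto τ atTop (𝓝 0))
    (hb : ∀ (m n : ℕ) ω, ∀ j ∈ Ico 1 m,
      IsAQR (τ n) ((j : ℝ) / m) n (fun i => Xs i ω) (fun i => Zs i ω) (b m n ω j))
    (ht : ∀ (m n : ℕ) ω, ∀ i,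
      IsIsotonicRegression m (fun j => b m n ω j i) (fun j => t m n ω j i))
    {η : ℝ} (hη : η ∈ Ioo (0 : ℝ) (1 / 2)) (i : Fin (d + 1)) {ε : ℝ} (hε : 0 < ε) :
    HighProb μ (atTop ×ˢ atTop) fun (a : ℕ × ℕ) ω =>
      ∀ j ∈ Ico 1 a.1, (j : ℝ) / a.1 ∈ Icc η (1 - η) →
        |t a.1 a.2 ω j i - β i ((j : ℝ) / a.1)| ≤ ε := by
  have hsnd : Tendsto (fun a : ℕ × ℕ => a.2) (atTop ×ˢ atTop) atTop := tendsto_snd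
  obtain ⟨ε', hε', hiso⟩ := exists_isotonic_close (hmodel.beta_monotoneOn i)
    (hmodel.beta_continuousOn i) hη hε
  have hne : ∀ c : Fin (d + 1) → ℝ, c ≠ 0 → ∀ᵐ ω ∂μ, linPred c (X ω) ≠ 0 := fun c hc =>
    hA1.ae_linPred_ne_zero hmodel.measurable_X hc
  obtain ⟨η₁, hη₁, hlow⟩ := h.exists_highProb_sum_norm_le hint hY hne hτpos hτ hε'
  obtain ⟨η₂, hη₂, hup⟩ := (h.comp measurable_neg).exists_highProb_sum_norm_le hint hY.neg
    hne hτpos hτ hε'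
  obtain ⟨η', hη'0, hle, hle4, hle1, hle2⟩ :
      ∃ η' > 0, η' ≤ ε' ∧ η' ≤ 1 / 4 ∧ η' ≤ η₁ ∧ η' ≤ η₂ :=
    ⟨min (min ε' (1 / 4)) (min η₁ η₂), by positivity,
      (min_le_left _ _).trans (min_le_left _ _), (min_le_left _ _).trans (min_le_right _ _),
      (min_le_right _ _).trans (min_le_left _ _), (min_le_right _ _).trans (min_le_right _ _)⟩
  refine ((highProb_aqr_grid_close hmodel h hA1 hint hτpos hτ hb
    (show η' ∈ Ioo (0 : ℝ) (1 / 2) from ⟨hη'0, by linarith⟩) i hε').and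
    ((hlow.comp hsnd).and (hup.comp hsnd))).mono ?_
  rintro ⟨m, n⟩ ω ⟨h1, h2, h3⟩
  refine hiso η' hη'0 hle m _ _ (ht m n ω i) h1 (fun J hJ hJη => ?_) (fun J hJ hJη => ?_)
  · refine (Finset.sum_le_sum fun j _ => norm_le_pi_norm (b m n ω j) i).trans
      (h2 m (b m n ω) (hb m n ω) J hJ (hJη.trans ?_))
    gcongr
  -- the highest orders are the lowest orders of the reflected responses
  · have hrefl : ∀ j ∈ Ico 1 m, IsAQR (τ n) ((j : ℝ) / m) n (fun i => Xs i ω)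
        (fun i => -Zs i ω) (-b m n ω (m - j)) := by
      rintro j ⟨hj1, hj2⟩
      have h5 := (hb m n ω (m - j) ⟨by omega, by omega⟩).neg
      have hm : (m : ℝ) ≠ 0 := by
        have : m ≠ 0 := by omega
        exact_mod_cast this
      have e : 1 - ((m - j : ℕ) : ℝ) / m = (j : ℝ) / m := by
        rw [Nat.cast_sub hj2.le]
        field_simp
        ring
      rwa [e] at h5
    have h4 := h3 m (fun j => -b m n ω (m - j)) hrefl J hJ (hJη.trans (by gcongr))
    refine (Finset.sum_le_sum fun j _ => ?_).trans h4
    rw [norm_neg]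
    exact norm_le_pi_norm (b m n ω (m - j)) i

end Estimates

end

theorem mainTheorem2 {Ω : Type*} [MeasurableSpace Ω] (μ : Measure Ω) [IsProbabilityMeasure μ]
    {d : ℕ} (X : Ω → Fin d → ℝ) (Y : Ω → ℝ)
    (S : Set (Fin d → ℝ)) (κ : Kernel (Fin d → ℝ) ℝ) [IsMarkovKernel κ]
    (β : Fin (d + 1) → ℝ → ℝ) (hmodel : QRModel μ X Y S κ β)
    -- independent copies of `(X, Y)`
    (Xs : ℕ → Ω → Fin d → ℝ) (Ys : ℕ → Ω → ℝ)
    (hXs : ∀ i, Measurable (Xs i)) (hYs : ∀ i, Measurable (Ys i))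
    (hindep : iIndepFun (fun i ω => (Xs i ω, Ys i ω)) μ)
    (hident : ∀ i, IdentDistrib (fun ω => (Xs i ω, Ys i ω)) (fun ω => (X ω, Y ω)) μ μ)
    -- the three regularity assumptions
    (hA1 : CovariateDensity μ X) (hA2 : HolderCondDensity S κ) (hA3 : DesignConvergence μ Xs)
    -- the smoothing parameters
    (τ : ℕ → ℝ) (hτpos : ∀ n, 0 < τ n) (hτ : Tendsto τ atTop (𝓝 0))
    -- AQR estimates (any choice of minimisers) at the orders `j/m`, and their isotonic regressions
    (b t : ℕ → ℕ → Ω → ℕ → Fin (d + 1) → ℝ)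
    (hb : ∀ (m n : ℕ) ω, ∀ j ∈ Set.Ico 1 m,
      IsAQR (τ n) ((j : ℝ) / m) n (fun i => Xs i ω) (fun i => Real.log (Ys i ω)) (b m n ω j))
    (ht : ∀ (m n : ℕ) ω, ∀ i,
      IsIsotonicRegression m (fun j => b m n ω j i) (fun j => t m n ω j i))
    (η : ℝ) (hη : η ∈ Set.Ioo (0 : ℝ) (1 / 2)) :
    -- AQR
    ((∀ i, TendstoInProbUniformlyOn μ
        (fun (a : ℕ × ℕ) ω => coefCurve a.1 (b a.1 a.2 ω) i) (β i)
        (atTop ×ˢ atTop) (Set.Icc η (1 - η))) ∧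
      ∀ x ∈ S,
        TendstoInProbUniformlyOn μ
          (fun (a : ℕ × ℕ) ω => plugInQ (coefCurve a.1 (b a.1 a.2 ω)) x) (quantile (κ x))
          (atTop ×ˢ atTop) (Set.Icc η (1 - η)) ∧
        TendstoInProbUniformlyOn μ
          (fun (a : ℕ × ℕ) ω => qZ (plugInQ (coefCurve a.1 (b a.1 a.2 ω)) x))
          (qZ (quantile (κ x)))
          (atTop ×ˢ atTop) (Set.Icc η (1 - η)) ∧
        TendstoInMeasure μ
          (fun (a : ℕ × ℕ) ω => ∫ p in η..(1 - η), qZ (plugInQ (coefCurve a.1 (b a.1 a.2 ω)) x) p)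
          (atTop ×ˢ atTop) (fun _ => ∫ p in η..(1 - η), qZ (quantile (κ x)) p)) ∧
    -- IAQR
    (Integrable (fun ω => Real.log (Y ω)) μ →
      (∀ i, TendstoInProbUniformlyOn μ
        (fun (a : ℕ × ℕ) ω => coefCurve a.1 (t a.1 a.2 ω) i) (β i)
        (atTop ×ˢ atTop) (Set.Icc η (1 - η))) ∧
      ∀ x ∈ S,
        TendstoInProbUniformlyOn μ
          (fun (a : ℕ × ℕ) ω => plugInQ (coefCurve a.1 (t a.1 a.2 ω)) x) (quantile (κ x))
          (atTop ×ˢ atTop) (Set.Icc η (1 - η)) ∧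
        TendstoInProbUniformlyOn μ
          (fun (a : ℕ × ℕ) ω => qZ (plugInQ (coefCurve a.1 (t a.1 a.2 ω)) x))
          (qZ (quantile (κ x)))
          (atTop ×ˢ atTop) (Set.Icc η (1 - η)) ∧
        TendstoInMeasure μ
          (fun (a : ℕ × ℕ) ω => ∫ p in η..(1 - η), qZ (plugInQ (coefCurve a.1 (t a.1 a.2 ω)) x) p)
          (atTop ×ˢ atTop) (fun _ => ∫ p in η..(1 - η), qZ (quantile (κ x)) p)) := by
  have hiid : IsIIDCopies μ X Y Xs Ys :=
    ⟨hmodel.measurable_X, hmodel.measurable_Y, hXs, hYs, hindep, hident⟩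
  have hlog := hiid.comp Real.measurable_log
  have hint := hiid.integrable_designNorm hA3
  have hmeas : ∀ (m : ℕ) (c : ℕ → Fin (d + 1) → ℝ) (i : Fin (d + 1)),
      Measurable (coefCurve m c i) := fun m c i => measurable_linInterp m fun j => c j i
  have hB := tendstoInProbUniformlyOn_coefCurve hmodel.beta_continuousOn
    fun η hη i ε hε => highProb_aqr_grid_close hmodel hlog hA1 hint hτpos hτ hb hη i hε
  refine ⟨⟨hB η hη, fun x hx => hmodel.tendsto_of_coef
    (B := fun (a : ℕ × ℕ) ω => coefCurve a.1 (b a.1 a.2 ω))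
    (fun a ω => hmeas a.1 _) hB hη hx⟩, fun hY => ?_⟩
  have hT := tendstoInProbUniformlyOn_coefCurve hmodel.beta_continuousOn
    fun η hη i ε hε =>
      highProb_isotonic_grid_close hmodel hlog hA1 hint hY hτpos hτ hb ht hη i hε
  exact ⟨hT η hη, fun x hx => hmodel.tendsto_of_coef
    (B := fun (a : ℕ × ℕ) ω => coefCurve a.1 (t a.1 a.2 ω))
    (fun a ω => hmeas a.1 _) hT hη hx⟩
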